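/- Conventions. All 2-categories are small and strict. Composition of 1-cells and vertical composition of 2-cells are written by juxtaposition or $\circ$. Let $P\colon K\to L$ be a 2-functor. * A 2-cell $\gamma\colon g\Rightarrow h\colon x\to y$ of $K$ is *cartesian* (with respect to $P$) if for every 1-cell $k\colon x\to y$ and all 2-cells $\psi\colon k\Rightarrow h$, $\varphi\colon Pk\Rightarrow Pg$ with $P\psi=(P\gamma)\circ\varphi$ there is a unique 2-cell $\chi\colon k\Rightarrow g$ with $P\chi=\varphi$ and $\gamma\circ\chi=\psi$. $P$ is a *local fibration* if every 2-cell $\alpha\colon f\Rightarrow Pg$ in $L(Px,Py)$, with $g\colon x\to y$ in $K$, has a cartesian lift, i.e. there is a cartesian 2-cell $\hat\alpha\colon\hat g\Rightarrow g$ with $P\hat\alpha=\alpha$. * Let $h\colon a\to d$ be a 1-cell of $K$. Given $u\colon a\to b$ in $K$, $t\colon Pd\to Pb$ in $L$ and an invertible 2-cell $\alpha\colon t\circ Ph\Rightarrow Pu$, a *lift* of $(u,t,\alpha)$ is a 1-cell $\tilde t\colon d\to b$ with invertible 2-cells $\alpha_1\colon t\Rightarrow P\tilde t$ and $\alpha_2\colon\tilde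 t h\Rightarrow u$ such that $\alpha=(P\alpha_2)\circ(\alpha_1*Ph)$. The 1-cell $h$ is *opcartesian* if (1) every such $(u,t,\alpha)$ has a lift, and (2) for all lifts $(\tilde t,\alpha_1,\alpha_2)$ of $(u,t,\alpha)$ and $(\tilde t',\alpha_1',\alpha_2')$ of $(u',t',\alpha')$, where $u,u'\colon a\to b$ and $t,t'\colon Pd\to Pb$, and all 2-cells $\beta\colon t\Rightarrow t'$ and $\rho\colon u\Rightarrow u'$ with $(P\rho)\circ\alpha=\alpha'\circ(\beta*Ph)$, there is a unique 2-cell $\tilde\beta\colon\tilde t\Rightarrow\tilde t'$ with $(P\tilde\beta)\circ\alpha_1=\alpha_1'\circ\beta$ and $\rho\circ\alpha_2=\alpha_2'\circ(\tilde\beta*h)$. * $P$ is an *opfibration* if every 1-cell $f\colon Px\to z$ of $L$ has an opcartesian lift $\hat f\colon x\to\hat x$ (with $P\hat x=z$ and $P\hat f=f$), $P$ is a local fibration, and horizontal composites of cartesian 2-cells are cartesian. Let $F\colon J\to L$ be another 2-functor. The *strict pullback* $\mathrm{pb}(P,F)$ is the 2-category whose $k$-cells ($k=0,1,2$) are the pairs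 $(w_1,w_2)$ of $k$-cells of $K$ and $J$ with $Pw_1=Fw_2$, with componentwise composition. The *lax comma object* $P\downarrow F$ is the 2-category with objects $[x,f,z]$, $x\in K$, $z\in J$, $f\colon Px\to Fz$ a 1-cell of $L$; with 1-cells $[s,\alpha,t]\colon[x,f,z]\to[x',f',z']$, where $s\colon x\to x'$, $t\colon z\to z'$ are 1-cells and $\alpha\colon Ft\circ f\Rightarrow f'\circ Ps$ is a 2-cell of $L$ (not necessarily invertible for general $L$); and with 2-cells $[\varphi,\gamma]\colon[s,\alpha,t]\Rightarrow[s',\alpha',t']$, where $\varphi\colon s\Rightarrow s'$, $\gamma\colon t\Rightarrow t'$ are 2-cells with $(f'*P\varphi)\circ\alpha=\alpha'\circ(F\gamma*f)$. 1-cells are composed by composing $s$ and $t$ and pasting $\alpha$; 2-cells are composed componentwise. The *inclusion* $i\colon\mathrm{pb}(P,F)\to P\downarrow F$ is the 2-functor $(x,z)\mapsto[x,1,z]$, $(s,t)\mapsto[s,1,t]$, $(\varphi,\gamma)\mapsto[\varphi,\gamma]$. The *nerve* $NX$ of a 2-category $X$ is the simplicial set whose $p$-simplices are the normal oplax functors $[p]\to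 X$, where $[p]=\{0\le 1\le\dots\le p\}$ is regarded as a locally discrete 2-category; an oplax functor $S$, with structure 2-cells $S(g\circ f)\Rightarrow Sg\circ Sf$ and $S(1)\Rightarrow 1$, is *normal* if the latter are identities. The *classifying space* of $X$ is the geometric realization $|NX|$. **Theorem.** Let $P\colon K\to L$ be an opfibration of 2-categories and $F\colon J\to L$ any 2-functor. Assume that all 2-cells of $L$ are invertible. Then the inclusion $i\colon\mathrm{pb}(P,F)\to P\downarrow F$ induces a homotopy equivalence $|Ni|\colon|N\,\mathrm{pb}(P,F)|\to|N(P\downarrow F)|$ on classifying spaces. -/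

import Mathlib

open CategoryTheory Bicategory

universe w v u w₁ v₁ u₁ w₂ v₂ u₂ w₃ v₃ u₃

namespace TwoCat

section Comma
variable {X : Type u₁} [Bicategory.{w₁, v₁} X] {Y : Type u₂} [Bicategory.{w₂, v₂} Y]
  {Z : Type u₃} [Bicategory.{w₃, v₃} Z]

/-- An object `[x, f, z]` of the lax comma object of `F : X ⟶ Y` and `G : Z ⟶ Y`:
objects `x` of `X` and `z` of `Z` and a 1-cell `f : F x ⟶ G z`. -/
structure LaxComma (F : StrictPseudofunctor X Y) (G : StrictPseudofunctor Z Y) where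
  fst : X
  snd : Z
  mor : F.obj fst ⟶ G.obj snd

namespace LaxComma
variable {F : StrictPseudofunctor X Y} {G : StrictPseudofunctor Z Y}

/-- A 1-cell `[s, α, t]` of the lax comma object; `α` is a 2-cell from `G t ∘ f` to `f' ∘ F s`
(composites of 1-cells are written in diagrammatic order). -/
structure Hom (a b : LaxComma F G) where
  fst : a.fst ⟶ b.fst
  snd : a.snd ⟶ b.snd
  cell : a.mor ≫ G.map snd ⟶ F.map fst ≫ b.mor

/-- A 2-cell `[φ, γ]` of the lax comma object: a pair of 2-cells compatible with the
2-cells in `Y`. -/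
@[ext]
structure Hom₂ {a b : LaxComma F G} (p q : Hom a b) where
  fst : p.fst ⟶ q.fst
  snd : p.snd ⟶ q.snd
  w : p.cell ≫ F.map₂ fst ▷ b.mor = a.mor ◁ G.map₂ snd ≫ q.cell

/-- The identity 1-cell. The 2-cell component is the composite of structural isomorphisms, all of
which are identities when `Y` is a 2-category. -/
def Hom.id (a : LaxComma F G) : Hom a a where
  fst := 𝟙 a.fst
  snd := 𝟙 a.snd
  cell := a.mor ◁ (G.mapId a.snd).hom ≫ (ρ_ a.mor).hom ≫ (λ_ a.mor).inv ≫
    (F.mapId a.fst).inv ▷ a.mor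

/-- Composition of 1-cells: componentwise on 1-cells, pasting on the 2-cell components. -/
def Hom.comp {a b c : LaxComma F G} (p : Hom a b) (q : Hom b c) : Hom a c where
  fst := p.fst ≫ q.fst
  snd := p.snd ≫ q.snd
  cell := a.mor ◁ (G.mapComp p.snd q.snd).hom ≫
    (α_ a.mor (G.map p.snd) (G.map q.snd)).inv ≫
    p.cell ▷ G.map q.snd ≫
    (α_ (F.map p.fst) b.mor (G.map q.snd)).hom ≫
    F.map p.fst ◁ q.cell ≫
    (α_ (F.map p.fst) (F.map q.fst) c.mor).inv ≫
    (F.mapComp p.fst q.fst).inv ▷ c.mor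

instance : CategoryStruct (LaxComma F G) where
  Hom a b := Hom a b
  id a := Hom.id a
  comp p q := Hom.comp p q

/-- Vertical composition of 2-cells is componentwise. -/
instance homCategory (a b : LaxComma F G) : Category (a ⟶ b) where
  Hom p q := Hom₂ p q
  id p := ⟨𝟙 p.fst, 𝟙 p.snd, by simp⟩
  comp {p q r} η θ := ⟨η.fst ≫ θ.fst, η.snd ≫ θ.snd, by
    simp only [PrelaxFunctor.map₂_comp, comp_whiskerRight, whiskerLeft_comp, Category.assoc]
    rw [← θ.w, ← Category.assoc, η.w, Category.assoc]⟩
  id_comp _ := Hom₂.ext (Category.id_comp _) (Category.id_comp _)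
  comp_id _ := Hom₂.ext (Category.comp_id _) (Category.comp_id _)
  assoc _ _ _ := Hom₂.ext (Category.assoc _ _ _) (Category.assoc _ _ _)

@[ext]
theorem hom₂_ext {a b : LaxComma F G} {p q : a ⟶ b} {η θ : p ⟶ q}
    (h₁ : η.fst = θ.fst) (h₂ : η.snd = θ.snd) : η = θ := Hom₂.ext h₁ h₂

@[simp] theorem id_fst (a : LaxComma F G) : (𝟙 a : a ⟶ a).fst = 𝟙 a.fst := rfl
@[simp] theorem id_snd (a : LaxComma F G) : (𝟙 a : a ⟶ a).snd = 𝟙 a.snd := rfl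
@[simp] theorem comp_fst {a b c : LaxComma F G} (p : a ⟶ b) (q : b ⟶ c) :
    (p ≫ q).fst = p.fst ≫ q.fst := rfl
@[simp] theorem comp_snd {a b c : LaxComma F G} (p : a ⟶ b) (q : b ⟶ c) :
    (p ≫ q).snd = p.snd ≫ q.snd := rfl
@[simp] theorem id₂_fst {a b : LaxComma F G} (p : a ⟶ b) : (𝟙 p : p ⟶ p).fst = 𝟙 p.fst := rfl
@[simp] theorem id₂_snd {a b : LaxComma F G} (p : a ⟶ b) : (𝟙 p : p ⟶ p).snd = 𝟙 p.snd := rfl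
@[simp] theorem comp₂_fst {a b : LaxComma F G} {p q r : a ⟶ b} (η : p ⟶ q) (θ : q ⟶ r) :
    (η ≫ θ).fst = η.fst ≫ θ.fst := rfl
@[simp] theorem comp₂_snd {a b : LaxComma F G} {p q r : a ⟶ b} (η : p ⟶ q) (θ : q ⟶ r) :
    (η ≫ θ).snd = η.snd ≫ θ.snd := rfl

theorem id_cell (a : LaxComma F G) : (𝟙 a : a ⟶ a).cell =
    a.mor ◁ (G.mapId a.snd).hom ≫ (ρ_ a.mor).hom ≫ (λ_ a.mor).inv ≫
    (F.mapId a.fst).inv ▷ a.mor := rfl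

theorem comp_cell {a b c : LaxComma F G} (p : a ⟶ b) (q : b ⟶ c) : (p ≫ q).cell =
    a.mor ◁ (G.mapComp p.snd q.snd).hom ≫
    (α_ a.mor (G.map p.snd) (G.map q.snd)).inv ≫
    p.cell ▷ G.map q.snd ≫
    (α_ (F.map p.fst) b.mor (G.map q.snd)).hom ≫
    F.map p.fst ◁ q.cell ≫
    (α_ (F.map p.fst) (F.map q.fst) c.mor).inv ≫
    (F.mapComp p.fst q.fst).inv ▷ c.mor := rfl

/-- An invertible 2-cell from a pair of invertible 2-cells. -/
def isoMk {a b : LaxComma F G} {p q : a ⟶ b} (e₁ : p.fst ≅ q.fst) (e₂ : p.snd ≅ q.snd)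
    (h : p.cell ≫ F.map₂ e₁.hom ▷ b.mor = a.mor ◁ G.map₂ e₂.hom ≫ q.cell) : p ≅ q where
  hom := ⟨e₁.hom, e₂.hom, h⟩
  inv := ⟨e₁.inv, e₂.inv, by
    have h1 : a.mor ◁ G.map₂ e₂.inv ≫ p.cell ≫ F.map₂ e₁.hom ▷ b.mor = q.cell := by
      rw [h, ← Category.assoc, ← whiskerLeft_comp, ← PrelaxFunctor.map₂_comp]; simp
    rw [← h1]
    simp only [Category.assoc, ← comp_whiskerRight, ← PrelaxFunctor.map₂_comp]
    simp⟩
  hom_inv_id := Hom₂.ext e₁.hom_inv_id e₂.hom_inv_id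
  inv_hom_id := Hom₂.ext e₁.inv_hom_id e₂.inv_hom_id

theorem whiskerLeft_w {a b c : LaxComma F G} (p : a ⟶ b) {q r : b ⟶ c} (η : q ⟶ r) :
    (p ≫ q).cell ≫ F.map₂ (p.fst ◁ η.fst) ▷ c.mor =
      a.mor ◁ G.map₂ (p.snd ◁ η.snd) ≫ (p ≫ r).cell := by
  have h := congrArg (fun t => F.map p.fst ◁ t) η.w
  simp only [whiskerLeft_comp] at h
  simp only [comp_cell]
  simp
  rw [reassoc_of% h, associator_inv_naturality_right_assoc, whisker_exchange_assoc,
    associator_naturality_right_assoc]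

theorem whiskerRight_w {a b c : LaxComma F G} {p q : a ⟶ b} (η : p ⟶ q) (r : b ⟶ c) :
    (p ≫ r).cell ≫ F.map₂ (η.fst ▷ r.fst) ▷ c.mor = a.mor ◁ G.map₂ (η.snd ▷ r.snd) ≫ (q ≫ r).cell := by
  have h := congrArg (fun t => t ▷ G.map r.snd) η.w
  simp only [comp_whiskerRight, whisker_assoc, Category.assoc] at h
  have h' := congrArg (fun t => (α_ _ _ _).inv ≫ t) h
  simp only [Iso.inv_hom_id_assoc] at h'
  simp only [comp_cell]
  simp
  rw [← reassoc_of% h']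
  rw [← associator_inv_naturality_left_assoc, whisker_exchange_assoc,
    associator_naturality_left_assoc]

theorem associator_w {a b c d : LaxComma F G} (p : a ⟶ b) (q : b ⟶ c) (r : c ⟶ d) :
    ((p ≫ q) ≫ r).cell ≫ F.map₂ (α_ p.fst q.fst r.fst).hom ▷ d.mor =
      a.mor ◁ G.map₂ (α_ p.snd q.snd r.snd).hom ≫ (p ≫ q ≫ r).cell := by
  simp only [comp_cell]
  simp
  have h1 : (F.mapComp p.fst q.fst).inv ▷ c.mor ▷ G.map r.snd ≫
      (α_ _ _ _).hom ≫ F.map (p.fst ≫ q.fst) ◁ r.cell ≫ (α_ _ _ _).inv ≫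
      (F.mapComp p.fst q.fst).hom ▷ F.map r.fst ▷ d.mor =
      (α_ _ _ _).hom ≫ _ ◁ r.cell ≫ (α_ _ _ _).inv := by
    rw [associator_naturality_left_assoc, ← whisker_exchange_assoc,
      associator_inv_naturality_left_assoc, ← comp_whiskerRight, ← comp_whiskerRight]
    simp
  have h2 : a.mor ◁ G.map p.snd ◁ (G.mapComp q.snd r.snd).inv ≫
      (α_ _ _ _).inv ≫ p.cell ▷ G.map (q.snd ≫ r.snd) ≫ (α_ _ _ _).hom ≫
      F.map p.fst ◁ b.mor ◁ (G.mapComp q.snd r.snd).hom =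
      (α_ _ _ _).inv ≫ p.cell ▷ _ ≫ (α_ _ _ _).hom := by
    rw [associator_inv_naturality_right_assoc, whisker_exchange_assoc,
      associator_naturality_right_assoc, ← whiskerLeft_comp, ← whiskerLeft_comp]
    simp
  rw [reassoc_of% h1, reassoc_of% h2]
  bicategory

theorem leftUnitor_w {a b : LaxComma F G} (p : a ⟶ b) :
    (𝟙 a ≫ p).cell ≫ F.map₂ (λ_ p.fst).hom ▷ b.mor = a.mor ◁ G.map₂ (λ_ p.snd).hom ≫ p.cell := by
  simp only [comp_cell, id_cell]
  simp
  rw [associator_naturality_left_assoc, ← whisker_exchange_assoc]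
  have : (F.mapId a.fst).inv ▷ (F.map p.fst ≫ b.mor) ≫ (α_ _ _ _).inv ≫
      (F.mapId a.fst).hom ▷ F.map p.fst ▷ b.mor = (α_ _ _ _).inv := by
    rw [associator_inv_naturality_left_assoc, ← comp_whiskerRight, ← comp_whiskerRight]; simp
  rw [reassoc_of% this]
  simp

theorem rightUnitor_w {a b : LaxComma F G} (p : a ⟶ b) :
    (p ≫ 𝟙 b).cell ≫ F.map₂ (ρ_ p.fst).hom ▷ b.mor = a.mor ◁ G.map₂ (ρ_ p.snd).hom ≫ p.cell := by
  simp only [comp_cell, id_cell]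
  simp
  rw [← associator_naturality_right_assoc, ← whisker_exchange_assoc, associator_inv_naturality_right_assoc]
  simp

/-- Left whiskering is componentwise. -/
def Hom₂.whiskerLeft {a b c : LaxComma F G} (p : a ⟶ b) {q r : b ⟶ c} (η : q ⟶ r) :
    p ≫ q ⟶ p ≫ r := ⟨p.fst ◁ η.fst, p.snd ◁ η.snd, whiskerLeft_w p η⟩

/-- Right whiskering is componentwise. -/
def Hom₂.whiskerRight {a b c : LaxComma F G} {p q : a ⟶ b} (η : p ⟶ q) (r : b ⟶ c) :
    p ≫ r ⟶ q ≫ r := ⟨η.fst ▷ r.fst, η.snd ▷ r.snd, whiskerRight_w η r⟩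

/-- The lax comma object as a bicategory. -/
instance bicategory : Bicategory (LaxComma F G) where
  homCategory := homCategory
  whiskerLeft p _ _ η := Hom₂.whiskerLeft p η
  whiskerRight η r := Hom₂.whiskerRight η r
  associator p q r := isoMk (α_ p.fst q.fst r.fst) (α_ p.snd q.snd r.snd) (associator_w p q r)
  leftUnitor p := isoMk (λ_ p.fst) (λ_ p.snd) (leftUnitor_w p)
  rightUnitor p := isoMk (ρ_ p.fst) (ρ_ p.snd) (rightUnitor_w p)
  whiskerLeft_id _ _ := hom₂_ext (whiskerLeft_id _ _) (whiskerLeft_id _ _)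
  whiskerLeft_comp _ _ _ _ _ _ := hom₂_ext (whiskerLeft_comp _ _ _) (whiskerLeft_comp _ _ _)
  id_whiskerLeft _ := hom₂_ext (id_whiskerLeft _) (id_whiskerLeft _)
  comp_whiskerLeft _ _ _ _ _ := hom₂_ext (comp_whiskerLeft _ _ _) (comp_whiskerLeft _ _ _)
  id_whiskerRight _ _ := hom₂_ext (id_whiskerRight _ _) (id_whiskerRight _ _)
  comp_whiskerRight _ _ _ := hom₂_ext (comp_whiskerRight _ _ _) (comp_whiskerRight _ _ _)
  whiskerRight_id _ := hom₂_ext (whiskerRight_id _) (whiskerRight_id _)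
  whiskerRight_comp _ _ _ := hom₂_ext (whiskerRight_comp _ _ _) (whiskerRight_comp _ _ _)
  whisker_assoc _ _ _ _ _ := hom₂_ext (whisker_assoc _ _ _) (whisker_assoc _ _ _)
  whisker_exchange _ _ := hom₂_ext (whisker_exchange _ _) (whisker_exchange _ _)
  pentagon _ _ _ _ := hom₂_ext (pentagon _ _ _ _) (pentagon _ _ _ _)
  triangle _ _ := hom₂_ext (triangle _ _) (triangle _ _)

theorem hom_eq {a b : LaxComma F G} {p q : a ⟶ b} (h₁ : p.fst = q.fst) (h₂ : p.snd = q.snd)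
    (h : p.cell ≫ F.map₂ (eqToHom h₁) ▷ b.mor = a.mor ◁ G.map₂ (eqToHom h₂) ≫ q.cell) :
    p = q := by
  obtain ⟨s, t, α⟩ := p
  obtain ⟨s', t', α'⟩ := q
  obtain rfl : s = s' := h₁
  obtain rfl : t = t' := h₂
  simp at h
  rw [h]

theorem eq_conj_eqToHom {a b : LaxComma F G} {p p' q q' : a ⟶ b} (h : p = p') (h' : q' = q)
    (η : p ⟶ q) (θ : p' ⟶ q') (h₁ : HEq η.fst θ.fst) (h₂ : HEq η.snd θ.snd) :
    η = eqToHom h ≫ θ ≫ eqToHom h' := by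
  subst h h'
  simp only [eqToHom_refl, Category.id_comp, Category.comp_id]
  exact hom₂_ext (eq_of_heq h₁) (eq_of_heq h₂)

theorem eqToIso_hom_fst {a b : LaxComma F G} {p q : a ⟶ b} (h : p = q) :
    (eqToIso h).hom.fst = (eqToIso (congrArg Hom.fst h)).hom := by subst h; rfl

theorem eqToIso_hom_snd {a b : LaxComma F G} {p q : a ⟶ b} (h : p = q) :
    (eqToIso h).hom.snd = (eqToIso (congrArg Hom.snd h)).hom := by subst h; rfl

theorem assoc_eq [Strict X] [Strict Z] {a b c d : LaxComma F G} (p : a ⟶ b) (q : b ⟶ c) (r : c ⟶ d) :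
    (p ≫ q) ≫ r = p ≫ q ≫ r :=
  hom_eq (Strict.assoc _ _ _) (Strict.assoc _ _ _) (by
    have := associator_w p q r
    rwa [Strict.associator_eqToIso, Strict.associator_eqToIso] at this)

theorem id_comp_eq [Strict X] [Strict Z] {a b : LaxComma F G} (p : a ⟶ b) : 𝟙 a ≫ p = p :=
  hom_eq (Strict.id_comp _) (Strict.id_comp _) (by
    have := leftUnitor_w p
    rwa [Strict.leftUnitor_eqToIso, Strict.leftUnitor_eqToIso] at this)

theorem comp_id_eq [Strict X] [Strict Z] {a b : LaxComma F G} (p : a ⟶ b) : p ≫ 𝟙 b = p :=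
  hom_eq (Strict.comp_id _) (Strict.comp_id _) (by
    have := rightUnitor_w p
    rwa [Strict.rightUnitor_eqToIso, Strict.rightUnitor_eqToIso] at this)

/-- The lax comma object of 2-functors between 2-categories is a 2-category. -/
instance strict [Strict X] [Strict Z] : Strict (LaxComma F G) where
  id_comp p := id_comp_eq p
  comp_id p := comp_id_eq p
  assoc p q r := assoc_eq p q r
  leftUnitor_eqToIso p := Iso.ext (hom₂_ext
    ((congrArg Iso.hom (Strict.leftUnitor_eqToIso p.fst)).trans (eqToIso_hom_fst (id_comp_eq p)).symm)
    ((congrArg Iso.hom (Strict.leftUnitor_eqToIso p.snd)).trans (eqToIso_hom_snd (id_comp_eq p)).symm))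
  rightUnitor_eqToIso p := Iso.ext (hom₂_ext
    ((congrArg Iso.hom (Strict.rightUnitor_eqToIso p.fst)).trans (eqToIso_hom_fst (comp_id_eq p)).symm)
    ((congrArg Iso.hom (Strict.rightUnitor_eqToIso p.snd)).trans (eqToIso_hom_snd (comp_id_eq p)).symm))
  associator_eqToIso {a b c d} p q r := by
    have h : (p ≫ q) ≫ r = p ≫ q ≫ r := assoc_eq p q r
    exact Iso.ext (hom₂_ext
      ((congrArg Iso.hom (Strict.associator_eqToIso p.fst q.fst r.fst)).trans
        (eqToIso_hom_fst h).symm)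
      ((congrArg Iso.hom (Strict.associator_eqToIso p.snd q.snd r.snd)).trans
        (eqToIso_hom_snd h).symm))

end LaxComma
end Comma

section HEqLemmas
variable {L : Type u} [Bicategory.{w, v} L]

theorem heq_id {a a' : L} (ha : a = a') : HEq (𝟙 a) (𝟙 a') := by subst ha; rfl

theorem heq_comp {a a' b b' c c' : L} (ha : a = a') (hb : b = b') (hc : c = c')
    {f : a ⟶ b} {f' : a' ⟶ b'} {g : b ⟶ c} {g' : b' ⟶ c'} (hf : HEq f f') (hg : HEq g g') :
    HEq (f ≫ g) (f' ≫ g') := by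
  subst ha hb hc hf hg; rfl

theorem heq_id₂ {a a' b b' : L} (ha : a = a') (hb : b = b') {f : a ⟶ b} {f' : a' ⟶ b'}
    (hf : HEq f f') : HEq (𝟙 f) (𝟙 f') := by
  subst ha hb hf; rfl

theorem heq_comp₂ {a a' b b' : L} (ha : a = a') (hb : b = b') {f g h : a ⟶ b}
    {f' g' h' : a' ⟶ b'} (hf : HEq f f') (hg : HEq g g') (hh : HEq h h')
    {η : f ⟶ g} {η' : f' ⟶ g'} {θ : g ⟶ h} {θ' : g' ⟶ h'} (hη : HEq η η') (hθ : HEq θ θ') :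
    HEq (η ≫ θ) (η' ≫ θ') := by
  subst ha hb hf hg hh hη hθ; rfl

theorem heq_eqToHom {a a' b b' : L} (ha : a = a') (hb : b = b') {f g : a ⟶ b}
    {f' g' : a' ⟶ b'} (hf : HEq f f') (e : f = g) (e' : f' = g') :
    HEq (eqToHom e) (eqToHom e') := by
  subst ha hb hf e e'; rfl

theorem heq_whiskerLeft {a a' b b' c c' : L} (ha : a = a') (hb : b = b') (hc : c = c')
    {f : a ⟶ b} {f' : a' ⟶ b'} {g h : b ⟶ c} {g' h' : b' ⟶ c'} (hf : HEq f f')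
    (hg : HEq g g') (hh : HEq h h') {η : g ⟶ h} {η' : g' ⟶ h'} (hη : HEq η η') :
    HEq (f ◁ η) (f' ◁ η') := by
  subst ha hb hc hf hg hh hη; rfl

theorem heq_whiskerRight {a a' b b' c c' : L} (ha : a = a') (hb : b = b') (hc : c = c')
    {f g : a ⟶ b} {f' g' : a' ⟶ b'} {h : b ⟶ c} {h' : b' ⟶ c'} (hf : HEq f f')
    (hg : HEq g g') (hh : HEq h h') {η : f ⟶ g} {η' : f' ⟶ g'} (hη : HEq η η') :
    HEq (η ▷ h) (η' ▷ h') := by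
  subst ha hb hc hf hg hh hη; rfl

theorem eqToHom_comp_eq [Strict L] {a a' b b' : L} (ha : a = a') (hb : b = b')
    {f : a ⟶ b} {f' : a' ⟶ b'} (hf : HEq f f') : eqToHom ha ≫ f' = f ≫ eqToHom hb := by
  subst ha hb hf
  exact (Strict.id_comp f).trans (Strict.comp_id f).symm

theorem whisker_id_aux [Strict L] {a b : L} {f g : a ⟶ b} {i : a ⟶ a} {j : b ⟶ b}
    (hi : i = 𝟙 a) (hj : j = 𝟙 b) (η : f ⟶ g) (e : i ≫ f = f ≫ j) (e' : i ≫ g = g ≫ j) :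
    eqToHom e ≫ η ▷ j = i ◁ η ≫ eqToHom e' := by
  subst hi hj
  rw [id_whiskerLeft, whiskerRight_id]
  simp [Strict.leftUnitor_eqToIso, Strict.rightUnitor_eqToIso]

theorem eqToHom_naturality [Strict L] {a a' b b' : L} (ha : a = a') (hb : b = b')
    {f g : a ⟶ b} {f' g' : a' ⟶ b'} (hf : HEq f f') (hg : HEq g g')
    {η : f ⟶ g} {η' : f' ⟶ g'} (hη : HEq η η') :
    eqToHom (eqToHom_comp_eq ha hb hf) ≫ η ▷ eqToHom hb =
      eqToHom ha ◁ η' ≫ eqToHom (eqToHom_comp_eq ha hb hg) := by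
  subst ha hb hf hg hη
  exact whisker_id_aux rfl rfl η _ _

end HEqLemmas

section Pullback
variable {K : Type u₁} [Bicategory.{w₁, v₁} K] {L : Type u₂} [Bicategory.{w₂, v₂} L]
  {J : Type u₃} [Bicategory.{w₃, v₃} J]

/-- An object of the strict pullback of `P : K ⟶ L` and `F : J ⟶ L`: a pair of objects with the
same image in `L`. -/
structure StrictPullback (P : StrictPseudofunctor K L) (F : StrictPseudofunctor J L) where
  fst : K
  snd : J
  w : P.obj fst = F.obj snd

namespace StrictPullback
variable {P : StrictPseudofunctor K L} {F : StrictPseudofunctor J L}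

/-- A 1-cell of the strict pullback: a pair of 1-cells with the same image in `L`. The images have
end points that are only propositionally equal, hence `HEq`. -/
structure Hom (a b : StrictPullback P F) where
  fst : a.fst ⟶ b.fst
  snd : a.snd ⟶ b.snd
  w : HEq (P.map fst) (F.map snd)

/-- A 2-cell of the strict pullback: a pair of 2-cells with the same image in `L`. -/
@[ext]
structure Hom₂ {a b : StrictPullback P F} (p q : Hom a b) where
  fst : p.fst ⟶ q.fst
  snd : p.snd ⟶ q.snd
  w : HEq (P.map₂ fst) (F.map₂ snd)

instance : CategoryStruct (StrictPullback P F) where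
  Hom a b := Hom a b
  id a := ⟨𝟙 a.fst, 𝟙 a.snd, by rw [P.map_id, F.map_id]; exact heq_id a.w⟩
  comp {a b c} p q := ⟨p.fst ≫ q.fst, p.snd ≫ q.snd, by
    rw [P.map_comp, F.map_comp]; exact heq_comp a.w b.w c.w p.w q.w⟩

/-- Vertical composition of 2-cells is componentwise. -/
instance homCategory (a b : StrictPullback P F) : Category (a ⟶ b) where
  Hom p q := Hom₂ p q
  id p := ⟨𝟙 p.fst, 𝟙 p.snd, by
    rw [PrelaxFunctor.map₂_id, PrelaxFunctor.map₂_id]; exact heq_id₂ a.w b.w p.w⟩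
  comp {p q r} η θ := ⟨η.fst ≫ θ.fst, η.snd ≫ θ.snd, by
    rw [PrelaxFunctor.map₂_comp, PrelaxFunctor.map₂_comp]
    exact heq_comp₂ a.w b.w p.w q.w r.w η.w θ.w⟩
  id_comp _ := Hom₂.ext (Category.id_comp _) (Category.id_comp _)
  comp_id _ := Hom₂.ext (Category.comp_id _) (Category.comp_id _)
  assoc _ _ _ := Hom₂.ext (Category.assoc _ _ _) (Category.assoc _ _ _)

@[ext]
theorem hom₂_ext {a b : StrictPullback P F} {p q : a ⟶ b} {η θ : p ⟶ q}
    (h₁ : η.fst = θ.fst) (h₂ : η.snd = θ.snd) : η = θ := Hom₂.ext h₁ h₂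

theorem hom_eq {a b : StrictPullback P F} {p q : a ⟶ b} (h₁ : p.fst = q.fst)
    (h₂ : p.snd = q.snd) : p = q := by
  obtain ⟨s, t, h⟩ := p
  obtain ⟨s', t', h'⟩ := q
  obtain rfl : s = s' := h₁
  obtain rfl : t = t' := h₂
  rfl

theorem eqToIso_hom_fst {a b : StrictPullback P F} {p q : a ⟶ b} (h : p = q) :
    (eqToIso h).hom.fst = (eqToIso (congrArg Hom.fst h)).hom := by subst h; rfl

theorem eqToIso_hom_snd {a b : StrictPullback P F} {p q : a ⟶ b} (h : p = q) :
    (eqToIso h).hom.snd = (eqToIso (congrArg Hom.snd h)).hom := by subst h; rfl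

theorem whiskerLeft_w {a b c : StrictPullback P F} (p : a ⟶ b) {q r : b ⟶ c} (η : q ⟶ r) :
    HEq (P.map₂ (p.fst ◁ η.fst)) (F.map₂ (p.snd ◁ η.snd)) := by
  rw [P.map₂_whisker_left, F.map₂_whisker_left, P.mapComp_eq_eqToIso, F.mapComp_eq_eqToIso,
    P.mapComp_eq_eqToIso, F.mapComp_eq_eqToIso]
  have h₁ := heq_comp a.w b.w c.w p.w q.w
  have h₂ := heq_comp a.w b.w c.w p.w r.w
  have h₁' : HEq (P.map (p.fst ≫ q.fst)) (F.map (p.snd ≫ q.snd)) := (p ≫ q).w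
  have h₂' : HEq (P.map (p.fst ≫ r.fst)) (F.map (p.snd ≫ r.snd)) := (p ≫ r).w
  simp only [eqToIso.hom, eqToIso.inv]
  exact heq_comp₂ a.w c.w h₁' h₁ h₂' (heq_eqToHom a.w c.w h₁' _ _)
    (heq_comp₂ a.w c.w h₁ h₂ h₂' (heq_whiskerLeft a.w b.w c.w p.w q.w r.w η.w)
      (heq_eqToHom a.w c.w h₂ _ _))

theorem whiskerRight_w {a b c : StrictPullback P F} {p q : a ⟶ b} (η : p ⟶ q) (r : b ⟶ c) :
    HEq (P.map₂ (η.fst ▷ r.fst)) (F.map₂ (η.snd ▷ r.snd)) := by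
  rw [P.map₂_whisker_right, F.map₂_whisker_right, P.mapComp_eq_eqToIso, F.mapComp_eq_eqToIso,
    P.mapComp_eq_eqToIso, F.mapComp_eq_eqToIso]
  have h₁ := heq_comp a.w b.w c.w p.w r.w
  have h₂ := heq_comp a.w b.w c.w q.w r.w
  have h₁' : HEq (P.map (p.fst ≫ r.fst)) (F.map (p.snd ≫ r.snd)) := (p ≫ r).w
  have h₂' : HEq (P.map (q.fst ≫ r.fst)) (F.map (q.snd ≫ r.snd)) := (q ≫ r).w
  simp only [eqToIso.hom, eqToIso.inv]
  exact heq_comp₂ a.w c.w h₁' h₁ h₂' (heq_eqToHom a.w c.w h₁' _ _)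
    (heq_comp₂ a.w c.w h₁ h₂ h₂' (heq_whiskerRight a.w b.w c.w p.w q.w r.w η.w)
      (heq_eqToHom a.w c.w h₂ _ _))

/-- The invertible 2-cell with given components, when these are identities. -/
def isoMk {a b : StrictPullback P F} {p q : a ⟶ b} (e₁ : p.fst ≅ q.fst) (e₂ : p.snd ≅ q.snd)
    (h₁ : p.fst = q.fst) (h₂ : p.snd = q.snd) (he₁ : e₁ = eqToIso h₁) (he₂ : e₂ = eqToIso h₂) :
    p ≅ q where
  hom := ⟨e₁.hom, e₂.hom, by
    rw [he₁, he₂, eqToIso.hom, eqToIso.hom, PrelaxFunctor.map₂_eqToHom,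
      PrelaxFunctor.map₂_eqToHom]
    exact heq_eqToHom a.w b.w p.w _ _⟩
  inv := ⟨e₁.inv, e₂.inv, by
    rw [he₁, he₂, eqToIso.inv, eqToIso.inv, PrelaxFunctor.map₂_eqToHom,
      PrelaxFunctor.map₂_eqToHom]
    exact heq_eqToHom a.w b.w q.w _ _⟩
  hom_inv_id := Hom₂.ext e₁.hom_inv_id e₂.hom_inv_id
  inv_hom_id := Hom₂.ext e₁.inv_hom_id e₂.inv_hom_id

/-- Left whiskering is componentwise. -/
def Hom₂.whiskerLeft {a b c : StrictPullback P F} (p : a ⟶ b) {q r : b ⟶ c} (η : q ⟶ r) :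
    p ≫ q ⟶ p ≫ r := ⟨p.fst ◁ η.fst, p.snd ◁ η.snd, whiskerLeft_w p η⟩

/-- Right whiskering is componentwise. -/
def Hom₂.whiskerRight {a b c : StrictPullback P F} {p q : a ⟶ b} (η : p ⟶ q) (r : b ⟶ c) :
    p ≫ r ⟶ q ≫ r := ⟨η.fst ▷ r.fst, η.snd ▷ r.snd, whiskerRight_w η r⟩

/-- The strict pullback as a bicategory. -/
instance bicategory [Strict K] [Strict J] : Bicategory (StrictPullback P F) where
  homCategory := homCategory
  whiskerLeft p _ _ η := Hom₂.whiskerLeft p η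
  whiskerRight η r := Hom₂.whiskerRight η r
  associator p q r := isoMk (α_ p.fst q.fst r.fst) (α_ p.snd q.snd r.snd)
    (Strict.assoc _ _ _) (Strict.assoc _ _ _)
    (Strict.associator_eqToIso _ _ _) (Strict.associator_eqToIso _ _ _)
  leftUnitor p := isoMk (λ_ p.fst) (λ_ p.snd) (Strict.id_comp _) (Strict.id_comp _)
    (Strict.leftUnitor_eqToIso _) (Strict.leftUnitor_eqToIso _)
  rightUnitor p := isoMk (ρ_ p.fst) (ρ_ p.snd) (Strict.comp_id _) (Strict.comp_id _)
    (Strict.rightUnitor_eqToIso _) (Strict.rightUnitor_eqToIso _)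
  whiskerLeft_id _ _ := hom₂_ext (whiskerLeft_id _ _) (whiskerLeft_id _ _)
  whiskerLeft_comp _ _ _ _ _ _ := hom₂_ext (whiskerLeft_comp _ _ _) (whiskerLeft_comp _ _ _)
  id_whiskerLeft _ := hom₂_ext (id_whiskerLeft _) (id_whiskerLeft _)
  comp_whiskerLeft _ _ _ _ _ := hom₂_ext (comp_whiskerLeft _ _ _) (comp_whiskerLeft _ _ _)
  id_whiskerRight _ _ := hom₂_ext (id_whiskerRight _ _) (id_whiskerRight _ _)
  comp_whiskerRight _ _ _ := hom₂_ext (comp_whiskerRight _ _ _) (comp_whiskerRight _ _ _)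
  whiskerRight_id _ := hom₂_ext (whiskerRight_id _) (whiskerRight_id _)
  whiskerRight_comp _ _ _ := hom₂_ext (whiskerRight_comp _ _ _) (whiskerRight_comp _ _ _)
  whisker_assoc _ _ _ _ _ := hom₂_ext (whisker_assoc _ _ _) (whisker_assoc _ _ _)
  whisker_exchange _ _ := hom₂_ext (whisker_exchange _ _) (whisker_exchange _ _)
  pentagon _ _ _ _ := hom₂_ext (pentagon _ _ _ _) (pentagon _ _ _ _)
  triangle _ _ := hom₂_ext (triangle _ _) (triangle _ _)

theorem assoc_eq [Strict K] [Strict J] {a b c d : StrictPullback P F} (p : a ⟶ b) (q : b ⟶ c) (r : c ⟶ d) :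
    (p ≫ q) ≫ r = p ≫ q ≫ r :=
  hom_eq (Strict.assoc _ _ _) (Strict.assoc _ _ _)

theorem id_comp_eq [Strict K] [Strict J] {a b : StrictPullback P F} (p : a ⟶ b) : 𝟙 a ≫ p = p :=
  hom_eq (Strict.id_comp _) (Strict.id_comp _)

theorem comp_id_eq [Strict K] [Strict J] {a b : StrictPullback P F} (p : a ⟶ b) : p ≫ 𝟙 b = p :=
  hom_eq (Strict.comp_id _) (Strict.comp_id _)

/-- The strict pullback of 2-categories is a 2-category. -/
instance strict [Strict K] [Strict J] : Strict (StrictPullback P F) where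
  id_comp p := id_comp_eq p
  comp_id p := comp_id_eq p
  assoc p q r := assoc_eq p q r
  leftUnitor_eqToIso p := Iso.ext (hom₂_ext
    ((congrArg Iso.hom (Strict.leftUnitor_eqToIso p.fst)).trans (eqToIso_hom_fst (id_comp_eq p)).symm)
    ((congrArg Iso.hom (Strict.leftUnitor_eqToIso p.snd)).trans (eqToIso_hom_snd (id_comp_eq p)).symm))
  rightUnitor_eqToIso p := Iso.ext (hom₂_ext
    ((congrArg Iso.hom (Strict.rightUnitor_eqToIso p.fst)).trans (eqToIso_hom_fst (comp_id_eq p)).symm)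
    ((congrArg Iso.hom (Strict.rightUnitor_eqToIso p.snd)).trans (eqToIso_hom_snd (comp_id_eq p)).symm))
  associator_eqToIso {a b c d} p q r := by
    have h : (p ≫ q) ≫ r = p ≫ q ≫ r := assoc_eq p q r
    exact Iso.ext (hom₂_ext
      ((congrArg Iso.hom (Strict.associator_eqToIso p.fst q.fst r.fst)).trans
        (eqToIso_hom_fst h).symm)
      ((congrArg Iso.hom (Strict.associator_eqToIso p.snd q.snd r.snd)).trans
        (eqToIso_hom_snd h).symm))

variable (P F) in
/-- The inclusion of the strict pullback into the lax comma object. It sends `(x, z)` to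
`[x, 1, z]`, a 1-cell `(s, t)` to `[s, 1, t]` and a 2-cell `(φ, γ)` to `[φ, γ]`; here the identities
are `eqToHom`s, because `P x` and `F z` are only propositionally equal. -/
def inclusion [Strict K] [Strict L] [Strict J] :
    StrictPseudofunctor (StrictPullback P F) (LaxComma P F) :=
  StrictPseudofunctor.mk'' {
    obj := fun a => ⟨a.fst, a.snd, eqToHom a.w⟩
    map := fun {a b} p => LaxComma.Hom.mk p.fst p.snd (eqToHom (eqToHom_comp_eq a.w b.w p.w))
    map₂ := fun {a b p q} η => LaxComma.Hom₂.mk η.fst η.snd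
      (eqToHom_naturality a.w b.w p.w q.w η.w)
    map₂_id := fun _ => rfl
    map₂_comp := fun _ _ => rfl
    map_id := fun a => LaxComma.hom_eq rfl rfl (by
      rw [LaxComma.id_cell, P.mapId_eq_eqToIso, F.mapId_eq_eqToIso, Strict.leftUnitor_eqToIso,
        Strict.rightUnitor_eqToIso]
      simp)
    map_comp := fun p q => LaxComma.hom_eq rfl rfl (by
      rw [LaxComma.comp_cell, P.mapComp_eq_eqToIso, F.mapComp_eq_eqToIso]
      simp only [Strict.associator_eqToIso]
      simp)
    map₂_whisker_left := fun {_ _ _} _ {_ _} _ =>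
      LaxComma.eq_conj_eqToHom _ _ _ _ HEq.rfl HEq.rfl
    map₂_whisker_right := fun {_ _ _ _ _} _ _ =>
      LaxComma.eq_conj_eqToHom _ _ _ _ HEq.rfl HEq.rfl }

end StrictPullback
end Pullback

section Nerve

/-- A normal oplax functor: the unit constraints `S (𝟙 x) ⟶ 𝟙 (S x)` are identities. -/
structure NormalOplaxFunctor (B : Type u₁) [Bicategory.{w₁, v₁} B] (C : Type u₂)
    [Bicategory.{w₂, v₂} C] extends OplaxFunctor B C where
  map_id (x : B) : map (𝟙 x) = 𝟙 (obj x)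
  mapId_eq_eqToHom (x : B) : mapId x = eqToHom (map_id x)

namespace NormalOplaxFunctor
variable {B : Type u₁} [Bicategory.{w₁, v₁} B] {C : Type u₂} [Bicategory.{w₂, v₂} C]
  {D : Type u₃} [Bicategory.{w₃, v₃} D]

/-- Composition of normal oplax functors. -/
def comp (S : NormalOplaxFunctor B C) (H : NormalOplaxFunctor C D) : NormalOplaxFunctor B D where
  toOplaxFunctor := S.toOplaxFunctor.comp H.toOplaxFunctor
  map_id x := (congrArg H.map (S.map_id x)).trans (H.map_id _)
  mapId_eq_eqToHom x := by
    change H.map₂ (S.mapId x) ≫ H.mapId (S.obj x) = _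
    rw [S.mapId_eq_eqToHom, H.mapId_eq_eqToHom, PrelaxFunctor.map₂_eqToHom]
    exact eqToHom_trans _ _

/-- A 2-functor is a normal oplax functor. -/
def ofStrict (H : StrictPseudofunctor B C) : NormalOplaxFunctor B C where
  toOplaxFunctor := H.toPseudofunctor.toOplax
  map_id := H.map_id
  mapId_eq_eqToHom x := congrArg Iso.hom (H.mapId_eq_eqToIso x)

/-- The action of a monotone map `φ : [m] ⟶ [n]` on 1-cells of the locally discrete 2-categories. -/
def pushHom {m n : ℕ} (φ : Fin (m + 1) →o Fin (n + 1))
    {i j : LocallyDiscrete (Fin (m + 1))} (f : i ⟶ j) :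
    (⟨φ i.as⟩ : LocallyDiscrete (Fin (n + 1))) ⟶ ⟨φ j.as⟩ :=
  ⟨homOfLE (φ.monotone (leOfHom f.as))⟩

/-- Restriction of a normal oplax functor `[n] ⟶ C` along a monotone map `φ : [m] ⟶ [n]`. -/
def restrict {m n : ℕ} (φ : Fin (m + 1) →o Fin (n + 1))
    (S : NormalOplaxFunctor (LocallyDiscrete (Fin (n + 1))) C) :
    NormalOplaxFunctor (LocallyDiscrete (Fin (m + 1))) C where
  obj i := S.obj ⟨φ i.as⟩
  map f := S.map (pushHom φ f)
  map₂ η := S.map₂ (eqToHom (congrArg (pushHom φ) (LocallyDiscrete.eq_of_hom η)))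
  map₂_id f := S.map₂_id (pushHom φ f)
  map₂_comp η θ := by
    rw [← S.map₂_comp, eqToHom_trans]
  mapId i := S.mapId ⟨φ i.as⟩
  mapComp f g := S.mapComp (pushHom φ f) (pushHom φ g)
  mapComp_naturality_left {i j k f f'} η g := by
    obtain rfl := LocallyDiscrete.eq_of_hom η
    exact S.mapComp_naturality_left (𝟙 (pushHom φ f)) (pushHom φ g)
  mapComp_naturality_right {i j k} f {g g'} η := by
    obtain rfl := LocallyDiscrete.eq_of_hom η
    exact S.mapComp_naturality_right (pushHom φ f) (𝟙 (pushHom φ g))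
  map₂_associator f g h := S.map₂_associator (pushHom φ f) (pushHom φ g) (pushHom φ h)
  map₂_leftUnitor f := S.map₂_leftUnitor (pushHom φ f)
  map₂_rightUnitor f := S.map₂_rightUnitor (pushHom φ f)
  map_id i := S.map_id ⟨φ i.as⟩
  mapId_eq_eqToHom i := S.mapId_eq_eqToHom ⟨φ i.as⟩

end NormalOplaxFunctor

/-- The normal oplax nerve: `n`-simplices are the normal oplax functors `[n] ⟶ X`, where `[n]` is
regarded as a locally discrete 2-category. -/
def oplaxNerve (X : Type u) [Bicategory.{w, v} X] : SSet.{max u v w} where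
  obj n := NormalOplaxFunctor (LocallyDiscrete (Fin (n.unop.len + 1))) X
  map f := ↾fun S => S.restrict f.unop.toOrderHom
  map_id _ := rfl
  map_comp _ _ := rfl

/-- The map of nerves induced by a normal oplax functor, by composition. -/
def oplaxNerveMap {X Y : Type u} [Bicategory.{w, v} X] [Bicategory.{w, v} Y]
    (H : NormalOplaxFunctor X Y) : oplaxNerve X ⟶ oplaxNerve Y where
  app _ := ↾fun S => S.comp H
  naturality _ _ _ := rfl

/-- The classifying space of a 2-category: the geometric realization of its nerve. -/
noncomputable def classifyingSpace (X : Type u) [Bicategory.{w, v} X] : TopCat.{max u v w} :=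
  SSet.toTop.obj (oplaxNerve X)

/-- The continuous map on classifying spaces induced by a 2-functor. -/
noncomputable def classifyingMap {X Y : Type u} [Bicategory.{w, v} X] [Bicategory.{w, v} Y]
    (H : StrictPseudofunctor X Y) : C(classifyingSpace X, classifyingSpace Y) :=
  (SSet.toTop.map (oplaxNerveMap (NormalOplaxFunctor.ofStrict H))).hom

/-- A continuous map is a homotopy equivalence if it has a homotopy inverse. -/
def IsHomotopyEquivalence {A B : Type*} [TopologicalSpace A] [TopologicalSpace B]
    (f : C(A, B)) : Prop :=
  ∃ e : ContinuousMap.HomotopyEquiv A B, e.toFun = f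

end Nerve

section Opfib
variable {K : Type u₁} [Bicategory.{w₁, v₁} K] {L : Type u₂} [Bicategory.{w₂, v₂} L]

/-- A 2-cell `γ : g ⟶ h` of `K` is cartesian with respect to `P` if it is a cartesian morphism for
the functor on hom-categories induced by `P`. -/
def IsCartesian₂ (P : StrictPseudofunctor K L) {x y : K} {g h : x ⟶ y} (γ : g ⟶ h) : Prop :=
  ∀ (k : x ⟶ y) (ψ : k ⟶ h) (φ : P.map k ⟶ P.map g), P.map₂ ψ = φ ≫ P.map₂ γ →
    ∃! χ : k ⟶ g, P.map₂ χ = φ ∧ χ ≫ γ = ψ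

/-- `P` is a local fibration if it induces fibrations on hom-categories: each 2-cell
`α : f ⟶ P g` has a cartesian lift `γ : g' ⟶ g`. -/
def IsLocalFibration (P : StrictPseudofunctor K L) : Prop :=
  ∀ ⦃x y : K⦄ (g : x ⟶ y) (f : P.obj x ⟶ P.obj y) (α : f ⟶ P.map g),
    ∃ (g' : x ⟶ y) (γ : g' ⟶ g) (e : P.map g' = f),
      P.map₂ γ = eqToHom e ≫ α ∧ IsCartesian₂ P γ

/-- A lift `(hom, base, top)` of `(u, t, α)` along the 1-cell `h`, where `α : t ∘ P h ≅ P u`: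
the 2-cell `α` is the pasting of `base : t ≅ P hom` and `P top`, where `top : hom ∘ h ≅ u`. -/
structure OpcartesianLift (P : StrictPseudofunctor K L) {a d b : K} (h : a ⟶ d) (u : a ⟶ b)
    (t : P.obj d ⟶ P.obj b) (α : P.map h ≫ t ≅ P.map u) where
  hom : d ⟶ b
  base : t ≅ P.map hom
  top : h ≫ hom ≅ u
  fac : α.hom = P.map h ◁ base.hom ≫ (P.mapComp h hom).inv ≫ P.map₂ top.hom

/-- Opcartesian 1-cells: lifts of 1-cells exist, and 2-cells between lifted 1-cells lift
uniquely. -/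
structure IsOpcartesian (P : StrictPseudofunctor K L) {a d : K} (h : a ⟶ d) : Prop where
  exists_lift : ∀ ⦃b : K⦄ (u : a ⟶ b) (t : P.obj d ⟶ P.obj b) (α : P.map h ≫ t ≅ P.map u),
    Nonempty (OpcartesianLift P h u t α)
  existsUnique_lift₂ : ∀ ⦃b : K⦄ ⦃u u' : a ⟶ b⦄ ⦃t t' : P.obj d ⟶ P.obj b⦄
    (α : P.map h ≫ t ≅ P.map u) (α' : P.map h ≫ t' ≅ P.map u')
    (T : OpcartesianLift P h u t α) (T' : OpcartesianLift P h u' t' α')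
    (β : t ⟶ t') (ρ : u ⟶ u'),
    α.hom ≫ P.map₂ ρ = P.map h ◁ β ≫ α'.hom →
      ∃! β' : T.hom ⟶ T'.hom,
        T.base.hom ≫ P.map₂ β' = β ≫ T'.base.hom ∧
        T.top.hom ≫ ρ = h ◁ β' ≫ T'.top.hom

/-- A 2-functor is an opfibration if 1-cells `f : P x ⟶ z` have opcartesian lifts, it is a local
fibration, and horizontal composites of cartesian 2-cells are cartesian. -/
structure IsOpfibration (P : StrictPseudofunctor K L) : Prop where
  exists_opcartesian : ∀ ⦃x : K⦄ ⦃z : L⦄ (f : P.obj x ⟶ z),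
    ∃ (x' : K) (f' : x ⟶ x') (e : P.obj x' = z), P.map f' ≫ eqToHom e = f ∧ IsOpcartesian P f'
  isLocalFibration : IsLocalFibration P
  hcomp : ∀ ⦃x y z : K⦄ ⦃g h : x ⟶ y⦄ ⦃g' h' : y ⟶ z⦄ (γ : g ⟶ h) (γ' : g' ⟶ h'),
    IsCartesian₂ P γ → IsCartesian₂ P γ' → IsCartesian₂ P (γ ▷ g' ≫ h ◁ γ')

end Opfib

end TwoCat

/-! The inclusion `i` has a left biadjoint, given by pushing forward along opcartesian lifts, and
such a biadjunction becomes a homotopy equivalence of classifying spaces.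

For an object `[x, f, z]`, choose an opcartesian lift `h : x ⟶ x'` of `f`. It gives a 1-cell from
`[x, f, z]` to `i (x', z)` with components `h` and the identity of `z`. Precomposition with this
1-cell is an equivalence of hom-categories (`StrictPullback.isBiuniversal_arrow`). Indeed, the
2-cell `κ` of a 1-cell `[s, κ, t]` into `i a'` is invertible, because all 2-cells of `L` are. Hence
`s` extends along `h` to a 1-cell whose image in `L` is isomorphic to `F t`. The local fibration
replaces the isomorphism by an equality, so that the extension and `t` form a 1-cell of the strict
pullback. The 2-dimensional property of `h` does the same for 2-cells. Identities are opcartesian,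
so the identities of the objects `i a` are biuniversal too, which says that `i` is locally an
equivalence.

The rest holds for any 2-functor `I : X ⟶ Y` with these two properties
(`isHomotopyEquivalence_of_isBiuniversal`). Choosing biuniversal arrows gives a section of the
projection from the lax comma object of the identity of `Y` and `I` to `Y`. A 2-cell over
biuniversal arrows is determined by its component in `Y`, so the section is a normal oplax functor
without further coherence work (`LiftData.lift`). Its second component is the reflection. The lax
comma object carries a universal cylinder, which yields the unit homotopy. The same lifting
construction over `X × [1]`, with identities chosen at one end and the reflection at the other,
yields the counit homotopy.

A normal oplax functor on `X × [1]` gives a simplicial homotopy, and `homotopic_of_family` realizes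
it by an explicit prism decomposition: a point of a simplex is a probability measure on its
vertices, and cutting that measure at height `s` gives a measure on a chain of `[n] × [1]`. -/

namespace ChainMeasure

/-! ### Pushforward of probability measures on finite sets -/

theorem map_apply {X Y : Type*} [Fintype X] [Fintype Y] [DecidableEq Y] (f : X → Y)
    (s : stdSimplex ℝ X) (y : Y) : stdSimplex.map f s y = ∑ x with f x = y, s x := by
  rw [stdSimplex.map_coe, FunOnFinite.linearMap_apply_apply]

theorem map_apply_of_injective {X Y : Type*} [Fintype X] [Fintype Y] {f : X → Y}
    (hf : f.Injective) (s : stdSimplex ℝ X) (x : X) : stdSimplex.map f s (f x) = s x := by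
  classical
  rw [map_apply, Finset.sum_eq_single x]
  · simp only [Finset.mem_filter]
    intro b hb hne
    exact absurd (hf hb.2) hne
  · simp

theorem map_apply_pos_iff {X Y : Type*} [Fintype X] [Fintype Y] {f : X → Y}
    {s : stdSimplex ℝ X} (hs : ∀ x, 0 < s x) (y : Y) :
    0 < stdSimplex.map f s y ↔ y ∈ Set.range f := by
  classical
  rw [map_apply]
  constructor
  · intro h
    by_contra hy
    rw [Finset.sum_eq_zero] at h
    · exact lt_irrefl _ h
    · intro x hx
      exact absurd ⟨x, (Finset.mem_filter.1 hx).2⟩ hy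
  · rintro ⟨x, rfl⟩
    exact Finset.sum_pos (fun x _ => hs x) ⟨x, by simp⟩

theorem exists_map_eq_of_support {X Y : Type*} [Fintype X] [Fintype Y] {f : X → Y}
    (hf : f.Injective) (ν : stdSimplex ℝ Y) (h : ∀ y, y ∉ Set.range f → ν y = 0) :
    ∃ w : stdSimplex ℝ X, (∀ x, w x = ν (f x)) ∧ stdSimplex.map f w = ν := by
  classical
  have hsum : ∑ x, ν (f x) = 1 := by
    rw [← stdSimplex.sum_eq_one ν, ← Finset.sum_image (s := Finset.univ) (g := f) (f := fun y => ν y)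
      (fun a _ b _ hab => hf hab)]
    refine Finset.sum_subset (Finset.subset_univ _) fun y _ hy => h y ?_
    simpa using hy
  refine ⟨⟨fun x => ν (f x), fun x => ν.2.1 _, hsum⟩, fun _ => rfl, ?_⟩
  ext y
  by_cases hy : y ∈ Set.range f
  · obtain ⟨x, rfl⟩ := hy
    rw [map_apply_of_injective hf]; rfl
  · rw [h y hy, map_apply, Finset.sum_eq_zero]
    intro x hx
    exact absurd ⟨x, (Finset.mem_filter.1 hx).2⟩ hy

/-! ### Evaluating compatible families at measures supported on chains -/

section Evaluation
variable {Q : Type*} [PartialOrder Q] [Fintype Q] {α : Type*}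
  (E : ∀ p : ℕ, (Fin (p + 1) →o Q) → stdSimplex ℝ (Fin (p + 1)) → α)

/-- Compatibility of a family of functions on the simplices of a poset with monotone maps. -/
def Compatible : Prop :=
  ∀ ⦃m n : ℕ⦄ (θ : Fin (m + 1) →o Fin (n + 1)) (c : Fin (n + 1) →o Q)
    (w : stdSimplex ℝ (Fin (m + 1))), E m (c.comp θ) w = E n c (stdSimplex.map θ w)

variable {E}

/-- Analogue of the non-degenerate representative of a point in a realization: vertices of weight
zero are removed by faces and repeated vertices are merged by degeneracies. Compatibility keeps the
value of `E`, and the pushed-forward measure on `Q` does not change either. -/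
theorem Compatible.exists_reduced (hE : Compatible E) {p : ℕ} (c : Fin (p + 1) →o Q)
    (w : stdSimplex ℝ (Fin (p + 1))) :
    ∃ (q : ℕ) (c' : Fin (q + 1) →o Q) (w' : stdSimplex ℝ (Fin (q + 1))), StrictMono c' ∧
      (∀ i, 0 < w' i) ∧ stdSimplex.map c' w' = stdSimplex.map c w ∧ E q c' w' = E p c w := by
  induction p with
  | zero =>
    have : Unique (Fin (0 + 1)) := inferInstanceAs (Unique (Fin 1))
    refine ⟨0, c, w, Subsingleton.strictMono _, fun i => ?_, rfl, rfl⟩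
    rw [stdSimplex.eq_one_of_unique]; exact one_pos
  | succ k ih =>
    by_cases hc : StrictMono c
    · by_cases hw : ∀ i, 0 < w i
      · exact ⟨_, c, w, hc, hw, rfl, rfl⟩
      push Not at hw
      obtain ⟨j, hj⟩ := hw
      have hj : w j = 0 := le_antisymm hj (w.2.1 j)
      -- The vertex `j` carries no mass, so `w` comes from the face opposite to `j`.
      obtain ⟨w', -, hw'⟩ := exists_map_eq_of_support (f := j.succAbove)
        Fin.succAbove_right_injective w fun y hy => by
          obtain rfl : y = j := by simpa using hy
          exact hj
      obtain ⟨q, c'', w'', h1, h2, h3, h4⟩ := ih (c.comp j.succAboveOrderEmb.toOrderHom) w'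
      refine ⟨q, c'', w'', h1, h2, ?_, ?_⟩
      · rw [h3, ← hw', stdSimplex.map_comp_apply]; rfl
      · rw [h4, hE]
        exact congrArg _ hw'
    · rw [Fin.strictMono_iff_lt_succ] at hc
      push Not at hc
      obtain ⟨i, hi⟩ := hc
      have hi : c i.castSucc = c i.succ := by
        rcases (c.monotone (Fin.castSucc_lt_succ (i := i)).le).lt_or_eq with h | h
        · exact absurd h hi
        · exact h
      -- The chain takes the same value at `i` and `i + 1`, so it factors through the degeneracy
      -- that merges them; `c'` omits the second of the two.
      let σ : Fin (k + 1 + 1) →o Fin (k + 1) := ⟨i.predAbove, Fin.predAbove_right_monotone i⟩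
      let c' := c.comp i.succ.succAboveOrderEmb.toOrderHom
      have hcc : c'.comp σ = c := by
        ext j
        change c (i.succ.succAbove (i.predAbove j)) = c j
        by_cases hj : j = i.succ
        · subst hj
          rw [Fin.predAbove_succ_self, Fin.succAbove_succ_self, hi]
        · rw [Fin.succ_succAbove_predAbove hj]
      obtain ⟨q, c'', w'', h1, h2, h3, h4⟩ := ih c' (stdSimplex.map σ w)
      refine ⟨q, c'', w'', h1, h2, ?_, ?_⟩
      · have hcc' : (c' : Fin (k + 1) → Q) ∘ σ = c := congrArg DFunLike.coe hcc
        rw [h3, stdSimplex.map_comp_apply, hcc']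
      · rw [h4, ← hE, hcc]

/-- A reduced representative can be read off from the measure: its chain is the increasing
enumeration of the support, and its weights are the values of the measure there. -/
theorem Compatible.eq_of_map_eq (hE : Compatible E) {p p' : ℕ} {c : Fin (p + 1) →o Q}
    {c' : Fin (p' + 1) →o Q} {w : stdSimplex ℝ (Fin (p + 1))} {w' : stdSimplex ℝ (Fin (p' + 1))}
    (h : stdSimplex.map c w = stdSimplex.map c' w') : E p c w = E p' c' w' := by
  obtain ⟨q, d, x, hd, hx, hm, he⟩ := hE.exists_reduced c w
  obtain ⟨q', d', x', hd', hx', hm', he'⟩ := hE.exists_reduced c' w'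
  rw [← he, ← he']
  rw [← hm, ← hm'] at h
  have hr : Set.range d = Set.range d' := by
    ext y
    rw [← map_apply_pos_iff hx, ← map_apply_pos_iff hx', h]
  obtain rfl : q = q' := by
    have := congrArg Set.ncard hr
    rw [← Set.image_univ, ← Set.image_univ, Set.ncard_image_of_injective _ hd.injective,
      Set.ncard_image_of_injective _ hd'.injective, Set.ncard_univ, Set.ncard_univ] at this
    simpa using this
  obtain rfl : d = d' := OrderHom.ext _ _ ((hd.range_inj hd').1 hr)
  obtain rfl : x = x' := by
    ext i
    rw [← map_apply_of_injective hd.injective x, h, map_apply_of_injective hd.injective]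
  rfl

variable (E) in
open Classical in
/-- The value at a measure supported on a chain of a compatible family of functions. -/
noncomputable def value [Nonempty α] (ν : stdSimplex ℝ Q) : α :=
  -- Measures that are not supported on a chain get an arbitrary value.
  if h : ∃ x : (p : ℕ) × (Fin (p + 1) →o Q) × stdSimplex ℝ (Fin (p + 1)),
    stdSimplex.map x.2.1 x.2.2 = ν then E _ h.choose.2.1 h.choose.2.2 else Classical.arbitrary α

theorem Compatible.value_map [Nonempty α] (hE : Compatible E) {p : ℕ} (c : Fin (p + 1) →o Q)
    (w : stdSimplex ℝ (Fin (p + 1))) : value E (stdSimplex.map c w) = E p c w := by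
  have h : ∃ x : (p : ℕ) × (Fin (p + 1) →o Q) × stdSimplex ℝ (Fin (p + 1)),
    stdSimplex.map x.2.1 x.2.2 = stdSimplex.map c w := ⟨⟨p, c, w⟩, rfl⟩
  rw [value, dif_pos h]
  exact hE.eq_of_map_eq h.choose_spec

/-- The parameters whose measure is supported on a given chain form a closed set, on which the
barycentric coordinates along the chain depend continuously on the parameter. Finitely many such
sets cover, so the continuous restrictions glue. -/
theorem Compatible.continuous_value [Nonempty α] [TopologicalSpace α] (hE : Compatible E)
    (hcont : ∀ p c, Continuous (E p c)) {Z : Type*} [TopologicalSpace Z]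
    {ν : Z → stdSimplex ℝ Q} (hν : Continuous ν) {ι : Type*} [Finite ι] {p : ι → ℕ}
    (c : ∀ i, Fin (p i + 1) →o Q) (hc : ∀ i, StrictMono (c i))
    (hs : ∀ z, ∃ i, ∀ y, y ∉ Set.range (c i) → ν z y = 0) :
    Continuous fun z => value E (ν z) := by
  have hcoord (y : Q) : Continuous fun z => ν z y :=
    (continuous_apply y).comp (continuous_subtype_val.comp hν)
  refine (locallyFinite_of_finite fun i : ι => {z | ∀ y, y ∉ Set.range (c i) → ν z y = 0}).continuous
    ?_ ?_ ?_
  · ext z; simpa using hs z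
  · intro i
    have : {z | ∀ y, y ∉ Set.range (c i) → ν z y = 0} =
        ⋂ (y) (_ : y ∉ Set.range (c i)), {z | ν z y = 0} := by
      ext z; simp
    rw [this]
    exact isClosed_iInter fun y => isClosed_iInter fun _ => isClosed_eq (hcoord y) continuous_const
  · intro i
    rw [continuousOn_iff_continuous_domRestrict]
    choose w hw hw' using fun z : {z | ∀ y, y ∉ Set.range (c i) → ν z y = 0} =>
      exists_map_eq_of_support (hc i).injective (ν z) z.2
    have hwc : Continuous w := by
      refine Continuous.subtype_mk (f := fun z => (w z : Fin (p i + 1) → ℝ)) ?_ (fun z => (w z).2)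
      refine continuous_pi fun x => ?_
      simp only [hw]
      exact (hcoord _).comp continuous_subtype_val
    have : Set.domRestrict _ (fun z => value E (ν z)) = fun z => E (p i) (c i) (w z) := by
      funext z
      rw [← hE.value_map, hw']; rfl
    rw [this]
    exact (hcont _ _).comp hwc

end Evaluation

/-! ### The prism decomposition by cutting measures -/

section Prism

/-- The mass that a monotone rearrangement of `t` gives to the part of the `j`-th interval below `s`. -/
noncomputable def lowerPart {n : ℕ} (t : Fin n → ℝ) (s : ℝ) (j : Fin n) : ℝ :=
  min (∑ i ∈ Finset.Iic j, t i) s - min (∑ i ∈ Finset.Iio j, t i) s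

theorem sum_Iic_eq {n : ℕ} (t : Fin n → ℝ) (j : Fin n) :
    ∑ i ∈ Finset.Iic j, t i = ∑ i ∈ Finset.Iio j, t i + t j := by
  rw [← Finset.Iio_insert, Finset.sum_insert (by simp), add_comm]

/-- The sum telescopes, since a lower set of `Fin n` is an initial segment. Nonnegativity of `s`
serves the empty sum. -/
theorem sum_lowerPart {n : ℕ} (t : Fin n → ℝ) (s : ℝ) (hs : 0 ≤ s) (A : Finset (Fin n))
    (hA : IsLowerSet (A : Set (Fin n))) :
    ∑ j ∈ A, lowerPart t s j = min (∑ i ∈ A, t i) s := by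
  induction A using Finset.induction_on_max with
  | empty => simp [hs]
  | insert a A ha ih =>
    have hA' : A = Finset.Iio a := by
      ext j
      rw [Finset.mem_Iio]
      refine ⟨ha j, fun hj => ?_⟩
      have := hA hj.le (by simp)
      simp only [Finset.coe_insert, Set.mem_insert_iff, Finset.mem_coe] at this
      exact this.resolve_left hj.ne
    have hlow : IsLowerSet (A : Set (Fin n)) := by
      rw [hA', Finset.coe_Iio]; exact isLowerSet_Iio a
    have hnot : a ∉ A := fun h => lt_irrefl _ (ha a h)
    rw [Finset.sum_insert hnot, ih hlow, lowerPart, hA', Finset.Iio_insert]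
    ring

variable {n : ℕ}

theorem lowerPart_nonneg (t : stdSimplex ℝ (Fin n)) (s : ℝ) (j : Fin n) : 0 ≤ lowerPart t s j := by
  rw [lowerPart, sum_Iic_eq, sub_nonneg]
  exact min_le_min_right _ (le_add_of_nonneg_right (t.2.1 j))

theorem lowerPart_le (t : stdSimplex ℝ (Fin n)) (s : ℝ) (j : Fin n) : lowerPart t s j ≤ t j := by
  have h := t.2.1 j
  change 0 ≤ t j at h
  rw [lowerPart, sum_Iic_eq]
  rcases min_cases (∑ i ∈ Finset.Iio j, t i + t j) s with h1 | h1 <;>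
    rcases min_cases (∑ i ∈ Finset.Iio j, t i) s with h2 | h2 <;> linarith

/-- The measure on `Fin n × Fin 2` that cuts the measure `t` on `Fin n` at height `s`. -/
noncomputable def cut (t : stdSimplex ℝ (Fin n)) (s : ℝ) : stdSimplex ℝ (Fin n × Fin 2) :=
  ⟨fun x => if x.2 = 0 then lowerPart t s x.1 else t x.1 - lowerPart t s x.1, by
    rintro ⟨j, e⟩
    dsimp only
    split_ifs
    · exact lowerPart_nonneg t s j
    · exact sub_nonneg.2 (lowerPart_le t s j), by
    rw [Fintype.sum_prod_type, ← stdSimplex.sum_eq_one t]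
    refine Finset.sum_congr rfl fun j _ => ?_
    simp⟩

theorem continuous_cut :
    Continuous fun x : stdSimplex ℝ (Fin n) × ℝ => cut x.1 x.2 := by
  have hc (j : Fin n) : Continuous fun x : stdSimplex ℝ (Fin n) × ℝ => x.1 j :=
    (continuous_apply j).comp (continuous_subtype_val.comp continuous_fst)
  have hl (j : Fin n) : Continuous fun x : stdSimplex ℝ (Fin n) × ℝ => lowerPart x.1 x.2 j := by
    unfold lowerPart
    refine ((continuous_finsetSum _ fun i _ => hc i).min continuous_snd).sub
      ((continuous_finsetSum _ fun i _ => hc i).min continuous_snd)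
  refine Continuous.subtype_mk (continuous_pi fun ⟨j, e⟩ => ?_) _
  dsimp only
  split_ifs
  · exact hl j
  · exact (hc j).sub (hl j)

theorem sum_map {m : ℕ} (φ : Fin m → Fin n) (t : stdSimplex ℝ (Fin m)) (A : Finset (Fin n)) :
    ∑ l ∈ A, stdSimplex.map φ t l = ∑ i with φ i ∈ A, t i := by
  simp only [map_apply]
  rw [← Finset.sum_fiberwise_of_maps_to (s := Finset.univ.filter fun i => φ i ∈ A) (t := A) (g := φ)
    (by simp)]
  refine Finset.sum_congr rfl fun l hl => Finset.sum_congr ?_ fun _ _ => rfl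
  ext i
  simp only [Finset.mem_filter, Finset.mem_univ, true_and]
  exact ⟨fun h => ⟨h ▸ hl, h⟩, fun h => h.2⟩

theorem lowerPart_map {m : ℕ} (φ : Fin m →o Fin n) (t : stdSimplex ℝ (Fin m)) {s : ℝ} (hs : 0 ≤ s)
    (l : Fin n) : lowerPart (stdSimplex.map φ t) s l = ∑ i with φ i = l, lowerPart t s i := by
  rw [lowerPart, sum_map, sum_map]
  -- The preimages of `Iic l` and `Iio l` are lower sets by monotonicity, and they differ by the
  -- fibre over `l`.
  rw [← sum_lowerPart t s hs, ← sum_lowerPart t s hs, sub_eq_iff_eq_add, ← Finset.sum_union]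
  · refine Finset.sum_congr ?_ fun _ _ => rfl
    ext i
    simp only [Finset.mem_filter, Finset.mem_univ, true_and, Finset.mem_Iic, Finset.mem_union,
      Finset.mem_Iio]
    rw [le_iff_eq_or_lt]
  · rw [Finset.disjoint_left]
    intro i hi hi'
    simp only [Finset.mem_filter, Finset.mem_univ, true_and, Finset.mem_Iio] at hi hi'
    exact hi'.ne hi
  · intro i j hij hi
    simp only [Finset.coe_filter, Finset.mem_univ, true_and, Finset.mem_Iio, Set.mem_ofPred_eq] at hi ⊢
    exact (φ.monotone hij).trans_lt hi
  · intro i j hij hi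
    simp only [Finset.coe_filter, Finset.mem_univ, true_and, Finset.mem_Iic, Set.mem_ofPred_eq] at hi ⊢
    exact (φ.monotone hij).trans hi

/-- Cutting is natural for monotone maps because they keep the order in which the masses are
stacked. This makes the homotopies on the individual simplices fit together. -/
theorem cut_map {m : ℕ} (φ : Fin m →o Fin n) (t : stdSimplex ℝ (Fin m)) {s : ℝ} (hs : 0 ≤ s) :
    cut (stdSimplex.map φ t) s = stdSimplex.map (Prod.map φ id) (cut t s) := by
  have key (l : Fin n) (e : Fin 2) : stdSimplex.map (Prod.map φ id) (cut t s) (l, e) =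
      ∑ i with φ i = l, cut t s (i, e) := by
    rw [map_apply]
    refine (Finset.sum_nbij' (fun i => (i, e)) Prod.fst ?_ ?_ ?_ ?_ ?_).symm
    all_goals simp +contextual [Prod.ext_iff]
  ext ⟨l, e⟩
  rw [key]
  fin_cases e
  · exact lowerPart_map φ t hs l
  · change stdSimplex.map φ t l - lowerPart (stdSimplex.map φ t) s l =
      ∑ i with φ i = l, (t i - lowerPart t s i)
    rw [lowerPart_map φ t hs, map_apply, Finset.sum_sub_distrib]

theorem cut_eq_of_le (t : stdSimplex ℝ (Fin n)) {s : ℝ} (hs : 1 ≤ s) :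
    cut t s = stdSimplex.map (fun j => (j, 0)) t := by
  have hle (A : Finset (Fin n)) : ∑ i ∈ A, t i ≤ s := by
    refine le_trans ?_ ((stdSimplex.sum_eq_one t).le.trans hs)
    exact Finset.sum_le_sum_of_subset_of_nonneg (Finset.subset_univ _) fun i _ _ => t.2.1 i
  have hl (j : Fin n) : lowerPart t s j = t j := by
    rw [lowerPart, min_eq_left (hle _), min_eq_left (hle _), sum_Iic_eq]; ring
  ext ⟨j, e⟩
  fin_cases e
  · refine Eq.trans ?_ (map_apply_of_injective (f := fun j : Fin n => (j, (0 : Fin 2)))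
      (fun a b h => by simpa using h) t j).symm
    exact hl j
  · rw [map_apply, Finset.sum_eq_zero (by simp)]
    change t j - lowerPart t s j = 0
    rw [hl, sub_self]

theorem cut_zero_right (t : stdSimplex ℝ (Fin n)) :
    cut t 0 = stdSimplex.map (fun j => (j, 1)) t := by
  have hle (A : Finset (Fin n)) : 0 ≤ ∑ i ∈ A, t i := Finset.sum_nonneg fun i _ => t.2.1 i
  have hl (j : Fin n) : lowerPart t 0 j = 0 := by
    rw [lowerPart, min_eq_right (hle _), min_eq_right (hle _), sub_self]
  ext ⟨j, e⟩
  fin_cases e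
  · rw [map_apply, Finset.sum_eq_zero (by simp)]
    exact hl j
  · refine Eq.trans ?_ (map_apply_of_injective (f := fun j : Fin n => (j, (1 : Fin 2)))
      (fun a b h => by simpa using h) t j).symm
    change t j - lowerPart t 0 j = t j
    rw [hl, sub_zero]

/-- The maximal chain of `Fin (n + 1) × Fin 2` that steps up at `k`. -/
def prismChain (k : Fin (n + 1)) : Fin (n + 1 + 1) →o Fin (n + 1) × Fin 2 where
  toFun j := (k.predAbove j, if j ≤ k.castSucc then 0 else 1)
  monotone' i j hij := by
    refine ⟨Fin.predAbove_right_monotone k hij, ?_⟩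
    dsimp only
    split_ifs with h1 h2
    · exact le_rfl
    · exact Fin.zero_le _
    · exact absurd (hij.trans ‹_›) h1
    · exact le_rfl

theorem prismChain_of_le {k : Fin (n + 1)} {j : Fin (n + 1)} (h : j ≤ k) :
    prismChain k j.castSucc = (j, 0) := by
  change (k.predAbove j.castSucc, if j.castSucc ≤ k.castSucc then (0 : Fin 2) else 1) = _
  rw [Fin.predAbove_castSucc_of_le _ _ h, if_pos (by simpa using h)]

theorem prismChain_of_ge {k : Fin (n + 1)} {j : Fin (n + 1)} (h : k ≤ j) :
    prismChain k j.succ = (j, 1) := by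
  change (k.predAbove j.succ, if j.succ ≤ k.castSucc then (0 : Fin 2) else 1) = _
  rw [Fin.predAbove_succ_of_le _ _ h, if_neg]
  rw [not_le]
  exact Fin.castSucc_lt_succ_iff.2 h

theorem prismChain_strictMono (k : Fin (n + 1)) : StrictMono (prismChain k) := by
  refine (prismChain k).monotone.strictMono_of_injective fun i j h => ?_
  have h1 : k.predAbove i = k.predAbove j := congrArg Prod.fst h
  have h2 : (if i ≤ k.castSucc then (0 : Fin 2) else 1) = if j ≤ k.castSucc then 0 else 1 :=
    congrArg Prod.snd h
  have hi : i ≤ k.castSucc ↔ j ≤ k.castSucc := by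
    split_ifs at h2 with h3 h4 h4 <;> simp_all only [iff_self, zero_ne_one, one_ne_zero]
  by_cases hik : i ≤ k.castSucc
  · have hjk := hi.1 hik
    rw [Fin.predAbove_of_le_castSucc _ _ hik, Fin.predAbove_of_le_castSucc _ _ hjk] at h1
    simpa using h1
  · have hjk : ¬ j ≤ k.castSucc := fun h => hik (hi.2 h)
    rw [not_le] at hik hjk
    rw [Fin.predAbove_of_castSucc_lt _ _ hik, Fin.predAbove_of_castSucc_lt _ _ hjk] at h1
    simpa using h1

/-- Stack the masses `t 0, t 1, …` as consecutive intervals and let `k` be the last one that starts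
at or below height `s`. Earlier intervals lie entirely below `s` and later ones above it, so only
`k` can have mass on both levels. -/
theorem exists_cut_support (t : stdSimplex ℝ (Fin (n + 1))) {s : ℝ} (hs : 0 ≤ s) :
    ∃ k : Fin (n + 1), ∀ y, y ∉ Set.range (prismChain k) → cut t s y = 0 := by
  obtain ⟨k, hk, hmax⟩ := Finset.exists_max_image
    (Finset.univ.filter fun k : Fin (n + 1) => ∑ i ∈ Finset.Iio k, t i ≤ s) id
    ⟨0, by
      have : Finset.Iio (0 : Fin (n + 1)) = ∅ := by ext; simp
      simp [this, hs]⟩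
  simp only [Finset.mem_filter, Finset.mem_univ, true_and, id] at hk hmax
  refine ⟨k, ?_⟩
  rintro ⟨j, e⟩ hy
  rcases lt_trichotomy j k with h | rfl | h
  · have hle : ∑ i ∈ Finset.Iic j, t i ≤ s := by
      refine le_trans (Finset.sum_le_sum_of_subset_of_nonneg ?_ fun i _ _ => t.2.1 i) hk
      intro i hi
      exact Finset.mem_Iio.2 ((Finset.mem_Iic.1 hi).trans_lt h)
    have hle' : ∑ i ∈ Finset.Iio j, t i ≤ s := by
      rw [sum_Iic_eq] at hle
      have := t.2.1 j
      change 0 ≤ t j at this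
      linarith
    fin_cases e
    · exact absurd ⟨_, prismChain_of_le h.le⟩ hy
    · change t j - lowerPart t s j = 0
      rw [lowerPart, min_eq_left hle, min_eq_left hle', sum_Iic_eq]
      ring
  · fin_cases e
    · exact absurd ⟨_, prismChain_of_le le_rfl⟩ hy
    · exact absurd ⟨_, prismChain_of_ge le_rfl⟩ hy
  · have hlt : s < ∑ i ∈ Finset.Iio j, t i := by
      by_contra hcon
      exact absurd (hmax j (not_lt.1 hcon)) (not_le.2 h)
    fin_cases e
    · change lowerPart t s j = 0
      have := t.2.1 j
      change 0 ≤ t j at this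
      rw [lowerPart, sum_Iic_eq, min_eq_right hlt.le, min_eq_right (by linarith), sub_self]
    · exact absurd ⟨_, prismChain_of_ge h.le⟩ hy

end Prism

end ChainMeasure

namespace TwoCat

/-! ### Geometric realization and simplicial homotopies -/

section Realization
open Simplicial

/-- The point of the realization given by a simplex `y` and barycentric coordinates `w`. -/
noncomputable def point (Y : SSet.{u}) (n : ℕ) (y : Y.obj (Opposite.op ⦋n⦌))
    (w : stdSimplex ℝ (Fin (n + 1))) : SSet.toTop.obj Y :=
  SSet.toTop.map (SSet.yonedaEquiv.symm y) ((SimplexCategory.toTopHomeo ⦋n⦌).symm w)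

variable {X Y : SSet.{u}}

theorem continuous_point (n : ℕ) (y : Y.obj (Opposite.op ⦋n⦌)) : Continuous (point Y n y) :=
  (SSet.toTop.map (SSet.yonedaEquiv.symm y)).hom.continuous.comp
    (SimplexCategory.toTopHomeo ⦋n⦌).symm.continuous

theorem point_map {m n : ℕ} (θ : ⦋m⦌ ⟶ ⦋n⦌) (y : Y.obj (Opposite.op ⦋n⦌))
    (w : stdSimplex ℝ (Fin (m + 1))) :
    point Y m (Y.map θ.op y) w = point Y n y (stdSimplex.map θ.toOrderHom w) := by
  have h : SSet.yonedaEquiv.symm (Y.map θ.op y) =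
      SSet.stdSimplex.map θ ≫ SSet.yonedaEquiv.symm y := by
    rw [Equiv.symm_apply_eq, ← SSet.yonedaEquiv_naturality, Equiv.apply_symm_apply]
  rw [point, h, Functor.map_comp]
  exact congrArg (SSet.toTop.map (SSet.yonedaEquiv.symm y))
    (SimplexCategory.toTopHomeo_symm_naturality_apply θ w).symm

theorem toTop_map_point (f : X ⟶ Y) {n : ℕ} (x : X.obj (Opposite.op ⦋n⦌))
    (w : stdSimplex ℝ (Fin (n + 1))) :
    SSet.toTop.map f (point X n x w) = point Y n (f.app _ x) w := by
  rw [point, point, ← SSet.yonedaEquiv_symm_comp, Functor.map_comp]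
  rfl

/-- By the adjunction with the singular simplicial set, a map out of the realization amounts to a
compatible family of maps on simplices. The same reason gives `exists_desc`. -/
theorem point_hom_ext {T : TopCat.{u}} {f g : SSet.toTop.obj Y ⟶ T}
    (h : ∀ (n : ℕ) (y : Y.obj (Opposite.op ⦋n⦌)) (w : stdSimplex ℝ (Fin (n + 1))),
      f (point Y n y w) = g (point Y n y w)) : f = g := by
  refine (sSetTopAdj.homEquiv Y T).injective ?_
  ext ⟨n⟩ y
  induction n using SimplexCategory.rec with | _ n
  apply (TopCat.toSSetObjEquiv T _).injective
  ext w
  exact h n y w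

theorem exists_desc {T : TopCat.{u}}
    (g : ∀ n : ℕ, Y.obj (Opposite.op ⦋n⦌) → C(stdSimplex ℝ (Fin (n + 1)), T))
    (hg : ∀ (m n : ℕ) (θ : ⦋m⦌ ⟶ ⦋n⦌) (y : Y.obj (Opposite.op ⦋n⦌))
      (w : stdSimplex ℝ (Fin (m + 1))),
      g m (Y.map θ.op y) w = g n y (stdSimplex.map θ.toOrderHom w)) :
    ∃ f : SSet.toTop.obj Y ⟶ T, ∀ (n : ℕ) (y : Y.obj (Opposite.op ⦋n⦌))
      (w : stdSimplex ℝ (Fin (n + 1))), f (point Y n y w) = g n y w := by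
  let φ : Y ⟶ TopCat.toSSet.obj T :=
    { app n := ↾fun y => (TopCat.toSSetObjEquiv T n).symm (g n.unop.len y)
      naturality := by
        rintro ⟨n⟩ ⟨m⟩ ⟨θ⟩
        ext y
        apply (TopCat.toSSetObjEquiv T _).injective
        ext w
        exact hg _ _ θ y w }
  refine ⟨(sSetTopAdj.homEquiv Y T).symm φ, fun n y w => ?_⟩
  have h : (sSetTopAdj.homEquiv Y T) ((sSetTopAdj.homEquiv Y T).symm φ) = φ :=
    Equiv.apply_symm_apply _ _
  have h' := congrArg (fun ψ : Y ⟶ TopCat.toSSet.obj T =>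
    TopCat.toSSetObjEquiv T _ (ψ.app (Opposite.op ⦋n⦌) y) w) h
  exact h'

/-- A simplicial homotopy, given by a natural family indexed by the simplices of `X` and of the
interval, induces a homotopy between the realizations. -/
theorem homotopic_of_family (f g : X ⟶ Y)
    (H : ∀ n : ℕ, X.obj (Opposite.op ⦋n⦌) → (Fin (n + 1) →o Fin 2) → Y.obj (Opposite.op ⦋n⦌))
    (hH : ∀ (m n : ℕ) (θ : ⦋m⦌ ⟶ ⦋n⦌) (x : X.obj (Opposite.op ⦋n⦌)) (χ : Fin (n + 1) →o Fin 2),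
      H m (X.map θ.op x) (χ.comp θ.toOrderHom) = Y.map θ.op (H n x χ))
    (hf : ∀ (n : ℕ) (x : X.obj (Opposite.op ⦋n⦌)), H n x (OrderHom.const _ 0) = f.app _ x)
    (hg : ∀ (n : ℕ) (x : X.obj (Opposite.op ⦋n⦌)), H n x (OrderHom.const _ 1) = g.app _ x) :
    (SSet.toTop.map f).hom.Homotopic (SSet.toTop.map g).hom := by
  -- A chain in `[n] × [1]` has two components: the first pulls back `x`, the second selects the
  -- member of `H`.
  let E (n : ℕ) (x : X.obj (Opposite.op ⦋n⦌)) (p : ℕ) (c : Fin (p + 1) →o Fin (n + 1) × Fin 2)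
      (w : stdSimplex ℝ (Fin (p + 1))) : SSet.toTop.obj Y :=
    point Y p (H p (X.map (SimplexCategory.mkHom (OrderHom.fst.comp c) : ⦋p⦌ ⟶ ⦋n⦌).op x)
      (OrderHom.snd.comp c)) w
  have hE (n : ℕ) (x : X.obj (Opposite.op ⦋n⦌)) : ChainMeasure.Compatible (E n x) := by
    intro m q θ c w
    have h1 := hH m q (SimplexCategory.mkHom θ)
      (X.map (SimplexCategory.mkHom (OrderHom.fst.comp c) : ⦋q⦌ ⟶ ⦋n⦌).op x)
      (OrderHom.snd.comp c)
    have h2 := point_map (Y := Y) (SimplexCategory.mkHom θ : ⦋m⦌ ⟶ ⦋q⦌)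
      (H q (X.map (SimplexCategory.mkHom (OrderHom.fst.comp c) : ⦋q⦌ ⟶ ⦋n⦌).op x)
      (OrderHom.snd.comp c)) w
    refine Eq.trans ?_ h2
    rw [← h1, ← ConcreteCategory.comp_apply, ← X.map_comp]
    rfl
  have hne (n : ℕ) (x : X.obj (Opposite.op ⦋n⦌)) : Nonempty (SSet.toTop.obj Y) :=
    ⟨point Y n (f.app _ x) (stdSimplex.vertex 0)⟩
  have hcont (n : ℕ) (x : X.obj (Opposite.op ⦋n⦌)) :
      Continuous fun z : stdSimplex ℝ (Fin (n + 1)) × unitInterval =>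
        have := hne n x
        ChainMeasure.value (E n x) (ChainMeasure.cut z.1 z.2) := by
    have := hne n x
    exact (hE n x).continuous_value (fun p c => continuous_point _ _)
      (ChainMeasure.continuous_cut.comp (continuous_fst.prodMk
        (continuous_subtype_val.comp continuous_snd)))
      (fun k => ChainMeasure.prismChain k) ChainMeasure.prismChain_strictMono
      (fun z => ChainMeasure.exists_cut_support z.1 z.2.2.1)
  -- Currying the time variable reduces the homotopy to a map out of the realization of `X` alone,
  -- which can be defined simplex by simplex; no description of the realization of a product is
  -- needed.
  obtain ⟨Φ, hΦ⟩ := exists_desc (Y := X) (T := TopCat.of C(unitInterval, SSet.toTop.obj Y))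
    (fun n x => ContinuousMap.curry ⟨_, hcont n x⟩) (by
      intro m n θ x w
      have := hne n x
      refine ContinuousMap.ext fun s => ?_
      change ChainMeasure.value (E m (X.map θ.op x)) (ChainMeasure.cut w s) =
        ChainMeasure.value (E n x) (ChainMeasure.cut (stdSimplex.map θ.toOrderHom w) s)
      -- By naturality of the cut, both sides are evaluations along one chain in `[m] × [1]` and its
      -- image in `[n] × [1]`.
      obtain ⟨k, hk⟩ := ChainMeasure.exists_cut_support w s.2.1
      obtain ⟨w', -, hw'⟩ := ChainMeasure.exists_map_eq_of_support
        (ChainMeasure.prismChain_strictMono k).injective _ hk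
      rw [ChainMeasure.cut_map _ _ s.2.1, ← hw', stdSimplex.map_comp_apply]
      rw [(hE _ _).value_map]
      have := (hE n x).value_map ((θ.toOrderHom.prodMap OrderHom.id).comp
        (ChainMeasure.prismChain k)) w'
      refine Eq.trans ?_ this.symm
      dsimp only [E]
      rw [← ConcreteCategory.comp_apply, ← X.map_comp]
      rfl)
  have hcont : Continuous fun z : SSet.toTop.obj X × unitInterval =>
      (Φ z.1 : C(unitInterval, SSet.toTop.obj Y)) z.2 :=
    ContinuousMap.continuous_uncurry_of_continuous ⟨fun x => Φ x, Φ.hom.continuous⟩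
  have h0 : TopCat.ofHom ⟨fun x => (Φ x : C(unitInterval, SSet.toTop.obj Y)) 0,
      hcont.comp (continuous_id.prodMk continuous_const)⟩ = SSet.toTop.map g := by
    refine point_hom_ext fun n x w => ?_
    have := hne n x
    rw [toTop_map_point, ← hg]
    refine (congrArg (fun ψ : C(unitInterval, SSet.toTop.obj Y) => ψ 0) (hΦ n x w)).trans ?_
    change ChainMeasure.value (E n x) (ChainMeasure.cut w 0) = _
    rw [ChainMeasure.cut_zero_right]
    refine ((hE n x).value_map (OrderHom.id.prod (OrderHom.const _ 1)) w).trans ?_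
    dsimp only [E]
    congr 2
    exact congrArg (fun f => f x) (X.map_id _)
  have h1 : TopCat.ofHom ⟨fun x => (Φ x : C(unitInterval, SSet.toTop.obj Y)) 1,
      hcont.comp (continuous_id.prodMk continuous_const)⟩ = SSet.toTop.map f := by
    refine point_hom_ext fun n x w => ?_
    have := hne n x
    rw [toTop_map_point, ← hf]
    refine (congrArg (fun ψ : C(unitInterval, SSet.toTop.obj Y) => ψ 1) (hΦ n x w)).trans ?_
    change ChainMeasure.value (E n x) (ChainMeasure.cut w 1) = _
    rw [ChainMeasure.cut_eq_of_le _ le_rfl]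
    refine ((hE n x).value_map (OrderHom.id.prod (OrderHom.const _ 0)) w).trans ?_
    dsimp only [E]
    congr 2
    exact congrArg (fun f => f x) (X.map_id _)
  -- At time `0` the cut puts all mass on level `1`, so the homotopy runs from `g` to `f` and has to
  -- be reversed.
  refine ContinuousMap.Homotopic.symm ⟨{
    toFun z := (Φ z.2 : C(unitInterval, SSet.toTop.obj Y)) z.1
    continuous_toFun := hcont.comp continuous_swap
    map_zero_left x := congrArg (fun φ : SSet.toTop.obj X ⟶ SSet.toTop.obj Y => φ x) h0
    map_one_left x := congrArg (fun φ : SSet.toTop.obj X ⟶ SSet.toTop.obj Y => φ x) h1 }⟩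

end Realization

/-! ### Normal oplax functors on `[n]` and on cylinders -/

namespace NormalOplaxFunctor

/-- Normal oplax functors on a locally discrete 2-category are determined by their values on objects
and 1-cells and by their composition constraints. -/
theorem ext_of_isLocallyDiscrete {B : Type u₁} [Bicategory.{w₁, v₁} B] [IsLocallyDiscrete B]
    {C : Type u₂} [Bicategory.{w₂, v₂} C] {S T : NormalOplaxFunctor B C}
    (hobj : ∀ b, S.obj b = T.obj b)
    (hmap : ∀ ⦃a b : B⦄ (f : a ⟶ b), HEq (S.map f) (T.map f))
    (hcomp : ∀ ⦃a b c : B⦄ (f : a ⟶ b) (g : b ⟶ c), HEq (S.mapComp f g) (T.mapComp f g)) :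
    S = T := by
  obtain ⟨⟨⟨⟨⟨So, Sm⟩, Sm₂⟩, Sid₂, _⟩, Sid, Sc, _, _, _, _, _⟩, Si, Si'⟩ := S
  obtain ⟨⟨⟨⟨⟨To, Tm⟩, Tm₂⟩, Tid₂, _⟩, Tid, Tc, _, _, _, _, _⟩, Ti, Ti'⟩ := T
  obtain rfl : So = To := funext hobj
  obtain rfl : @Sm = @Tm := by
    funext a b f
    exact eq_of_heq (hmap f)
  obtain rfl : @Sm₂ = @Tm₂ := by
    funext a b f g η
    obtain rfl := obj_ext_of_isDiscrete η
    obtain rfl : η = 𝟙 f := Subsingleton.elim _ _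
    exact (Sid₂ f).trans (Tid₂ f).symm
  obtain rfl : @Sc = @Tc := by
    funext a b c f g
    exact eq_of_heq (hcomp f g)
  obtain rfl : Sid = Tid := funext fun x => (Si' x).trans (Ti' x).symm
  rfl

/-- The normal oplax functor `[n] ⟶ C × [1]` with given components. -/
def pair {n : ℕ} {C : Type u₂} [Bicategory.{w₂, v₂} C]
    (S : NormalOplaxFunctor (LocallyDiscrete (Fin (n + 1))) C) (χ : Fin (n + 1) →o Fin 2) :
    NormalOplaxFunctor (LocallyDiscrete (Fin (n + 1))) (C × LocallyDiscrete (Fin 2)) where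
  obj i := (S.obj i, ⟨χ i.as⟩)
  map {i j} f := (S.map f, pushHom (n := 1) χ f)
  map₂ η := (S.map₂ η, eqToHom (congrArg (pushHom (n := 1) χ) (LocallyDiscrete.eq_of_hom η)))
  map₂_id f := Prod.ext (S.map₂_id f) (Subsingleton.elim _ _)
  map₂_comp η θ := Prod.ext (S.map₂_comp η θ) (Subsingleton.elim _ _)
  mapId i := (S.mapId i, 𝟙 _)
  mapComp f g := (S.mapComp f g, 𝟙 _)
  mapComp_naturality_left η g := Prod.ext (S.mapComp_naturality_left η g) (Subsingleton.elim _ _)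
  mapComp_naturality_right f _ _ η :=
    Prod.ext (S.mapComp_naturality_right f η) (Subsingleton.elim _ _)
  map₂_associator f g h := Prod.ext (S.map₂_associator f g h) (Subsingleton.elim _ _)
  map₂_leftUnitor f := Prod.ext (S.map₂_leftUnitor f) (Subsingleton.elim _ _)
  map₂_rightUnitor f := Prod.ext (S.map₂_rightUnitor f) (Subsingleton.elim _ _)
  map_id i := Prod.ext (S.map_id i) rfl
  mapId_eq_eqToHom i := by
    have h (x y : C × LocallyDiscrete (Fin 2)) (f g : x ⟶ y) (e : f = g) :
        eqToHom e = ((eqToHom (congrArg Prod.fst e), eqToHom (congrArg Prod.snd e)) : f ⟶ g) := by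
      subst e; rfl
    rw [h]
    exact Prod.ext (S.mapId_eq_eqToHom i) (Subsingleton.elim _ _)

end NormalOplaxFunctor

open NormalOplaxFunctor

/-- A normal oplax functor on the cylinder `X × [1]` induces a homotopy between the realizations of
its two ends. -/
theorem homotopic_of_cylinder {X Y : Type u} [Bicategory.{w, v} X] [Bicategory.{w, v} Y]
    {f g : oplaxNerve X ⟶ oplaxNerve Y} (H : NormalOplaxFunctor (X × LocallyDiscrete (Fin 2)) Y)
    (hf : ∀ (n : ℕ) (S : NormalOplaxFunctor (LocallyDiscrete (Fin (n + 1))) X),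
      (S.pair (OrderHom.const _ 0)).comp H = f.app (Opposite.op (SimplexCategory.mk n)) S)
    (hg : ∀ (n : ℕ) (S : NormalOplaxFunctor (LocallyDiscrete (Fin (n + 1))) X),
      (S.pair (OrderHom.const _ 1)).comp H = g.app (Opposite.op (SimplexCategory.mk n)) S) :
    (SSet.toTop.map f).hom.Homotopic (SSet.toTop.map g).hom :=
  homotopic_of_family _ _ (fun _ S χ => (S.pair χ).comp H) (fun _ _ _ _ _ => rfl) hf hg

/-! ### The universal cylinder on a lax comma object -/

namespace LaxComma
variable {X : Type u₁} [Bicategory.{w₁, v₁} X] {Y : Type u₂} [Bicategory.{w₂, v₂} Y]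
  {Z : Type u₃} [Bicategory.{w₃, v₃} Z] {F : StrictPseudofunctor X Y} {G : StrictPseudofunctor Z Y}

/-- The two ends of an object of the lax comma object. -/
def cylObj (c : LaxComma F G) : Fin 2 → Y
  | 0 => F.obj c.fst
  | 1 => G.obj c.snd

/-- The 1-cells of the cylinder. -/
def cylMap {c d : LaxComma F G} (p : c ⟶ d) : ∀ {e e' : Fin 2}, e ≤ e' → (cylObj c e ⟶ cylObj d e')
  | 0, 0, _ => F.map p.fst
  | 0, 1, _ => c.mor ≫ G.map p.snd
  | 1, 1, _ => G.map p.snd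

/-- The 2-cells of the cylinder. -/
def cylMap₂ {c d : LaxComma F G} {p q : c ⟶ d} (η : p ⟶ q) :
    ∀ {e e' : Fin 2} (h : e ≤ e'), cylMap p h ⟶ cylMap q h
  | 0, 0, _ => F.map₂ η.fst
  | 0, 1, _ => c.mor ◁ G.map₂ η.snd
  | 1, 1, _ => G.map₂ η.snd

/-- The unit constraints of the cylinder. -/
def cylId (c : LaxComma F G) : ∀ e : Fin 2, cylMap (𝟙 c) (le_refl e) ⟶ 𝟙 (cylObj c e)
  | 0 => (F.mapId c.fst).hom
  | 1 => (G.mapId c.snd).hom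

/-- The composition constraints of the cylinder. -/
def cylComp {a b c : LaxComma F G} (p : a ⟶ b) (q : b ⟶ c) : ∀ {e e' e'' : Fin 2} (h : e ≤ e')
    (h' : e' ≤ e''), cylMap (p ≫ q) (h.trans h') ⟶ cylMap p h ≫ cylMap q h'
  | 0, 0, 0, _, _ => (F.mapComp p.fst q.fst).hom
  -- The only constraint that involves a 2-cell of the comma object. Its direction is the one that
  -- an oplax functor asks for.
  | 0, 0, 1, _, _ => a.mor ◁ (G.mapComp p.snd q.snd).hom ≫ (α_ _ _ _).inv ≫
      p.cell ▷ G.map q.snd ≫ (α_ _ _ _).hom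
  | 0, 1, 1, _, _ => a.mor ◁ (G.mapComp p.snd q.snd).hom ≫ (α_ _ _ _).inv
  | 1, 1, 1, _, _ => (G.mapComp p.snd q.snd).hom

/-- A case distinction for chains in `[1]`. -/
theorem fin_two_cases₂ {motive : ∀ e e' : Fin 2, e ≤ e' → Prop} (h00 : motive 0 0 le_rfl)
    (h01 : motive 0 1 (Fin.zero_le _)) (h11 : motive 1 1 le_rfl) : ∀ e e' h, motive e e' h
  | 0, 0, _ => h00
  | 0, 1, _ => h01
  | 1, 1, _ => h11

theorem cylMap₂_id {c d : LaxComma F G} (p : c ⟶ d) {e e' : Fin 2} (h : e ≤ e') :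
    cylMap₂ (𝟙 p) h = 𝟙 (cylMap p h) := by
  induction e, e', h using fin_two_cases₂ with
  | h00 => exact F.map₂_id _
  | h01 => exact (congrArg _ (G.map₂_id _)).trans (whiskerLeft_id _ _)
  | h11 => exact G.map₂_id _

theorem cylMap₂_comp {c d : LaxComma F G} {p q r : c ⟶ d} (η : p ⟶ q) (θ : q ⟶ r) {e e' : Fin 2}
    (h : e ≤ e') : cylMap₂ (η ≫ θ) h = cylMap₂ η h ≫ cylMap₂ θ h := by
  induction e, e', h using fin_two_cases₂ with
  | h00 => exact F.map₂_comp _ _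
  | h01 => exact (congrArg _ (G.map₂_comp _ _)).trans (whiskerLeft_comp _ _ _)
  | h11 => exact G.map₂_comp _ _

theorem whiskerRight_fst {a b c : LaxComma F G} {p q : a ⟶ b} (η : p ⟶ q) (r : b ⟶ c) :
    (η ▷ r).fst = η.fst ▷ r.fst := rfl

theorem whiskerLeft_fst {a b c : LaxComma F G} (p : a ⟶ b) {q r : b ⟶ c} (η : q ⟶ r) :
    (p ◁ η).fst = p.fst ◁ η.fst := rfl

/-- The `mixed` lemmas are the axioms for chains that pass from end `0` to end `1`. The number of
primes counts the factors before the one in which the passage happens. -/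
theorem mixed_naturality_left {a b c : LaxComma F G} {p p' : a ⟶ b} (η : p ⟶ p') (q : b ⟶ c) :
    a.mor ◁ G.map₂ (η.snd ▷ q.snd) ≫ a.mor ◁ (G.mapComp p'.snd q.snd).hom ≫ (α_ _ _ _).inv =
      (a.mor ◁ (G.mapComp p.snd q.snd).hom ≫ (α_ _ _ _).inv) ≫
        (a.mor ◁ G.map₂ η.snd) ▷ G.map q.snd := by
  simp

theorem mixed_naturality_left' {a b c : LaxComma F G} {p p' : a ⟶ b} (η : p ⟶ p') (q : b ⟶ c) :
    a.mor ◁ G.map₂ (η.snd ▷ q.snd) ≫ a.mor ◁ (G.mapComp p'.snd q.snd).hom ≫ (α_ _ _ _).inv ≫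
        p'.cell ▷ G.map q.snd ≫ (α_ _ _ _).hom =
      (a.mor ◁ (G.mapComp p.snd q.snd).hom ≫ (α_ _ _ _).inv ≫ p.cell ▷ G.map q.snd ≫
        (α_ _ _ _).hom) ≫ F.map₂ η.fst ▷ (b.mor ≫ G.map q.snd) := by
  have h := congrArg (fun t => t ▷ G.map q.snd) η.w
  simp only [comp_whiskerRight, whisker_assoc, Category.assoc] at h
  have h' := congrArg (fun t => (α_ _ _ _).inv ≫ t) h
  simp only [Iso.inv_hom_id_assoc] at h'
  simp
  rw [← reassoc_of% h']

theorem mixed_naturality_right {a b c : LaxComma F G} (p : a ⟶ b) {q q' : b ⟶ c} (η : q ⟶ q') :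
    a.mor ◁ G.map₂ (p.snd ◁ η.snd) ≫ a.mor ◁ (G.mapComp p.snd q'.snd).hom ≫ (α_ _ _ _).inv =
      (a.mor ◁ (G.mapComp p.snd q.snd).hom ≫ (α_ _ _ _).inv) ≫
        (a.mor ≫ G.map p.snd) ◁ G.map₂ η.snd := by
  simp

theorem mixed_naturality_right' {a b c : LaxComma F G} (p : a ⟶ b) {q q' : b ⟶ c} (η : q ⟶ q') :
    a.mor ◁ G.map₂ (p.snd ◁ η.snd) ≫ a.mor ◁ (G.mapComp p.snd q'.snd).hom ≫ (α_ _ _ _).inv ≫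
        p.cell ▷ G.map q'.snd ≫ (α_ _ _ _).hom =
      (a.mor ◁ (G.mapComp p.snd q.snd).hom ≫ (α_ _ _ _).inv ≫ p.cell ▷ G.map q.snd ≫
        (α_ _ _ _).hom) ≫ F.map p.fst ◁ b.mor ◁ G.map₂ η.snd := by
  simp
  rw [associator_inv_naturality_right_assoc, whisker_exchange_assoc]
  simp

theorem mixed_associator {a b c d : LaxComma F G} (p : a ⟶ b) (q : b ⟶ c) (r : c ⟶ d) :
    a.mor ◁ G.map₂ (α_ p.snd q.snd r.snd).hom ≫
        (a.mor ◁ (G.mapComp p.snd (q.snd ≫ r.snd)).hom ≫ (α_ _ _ _).inv) ≫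
          (a.mor ≫ G.map p.snd) ◁ (G.mapComp q.snd r.snd).hom =
      (a.mor ◁ (G.mapComp (p.snd ≫ q.snd) r.snd).hom ≫ (α_ _ _ _).inv) ≫
        (a.mor ◁ (G.mapComp p.snd q.snd).hom ≫ (α_ _ _ _).inv) ▷ G.map r.snd ≫
          (α_ _ _ _).hom := by
  simp

theorem mixed_associator' {a b c d : LaxComma F G} (p : a ⟶ b) (q : b ⟶ c) (r : c ⟶ d) :
    a.mor ◁ G.map₂ (α_ p.snd q.snd r.snd).hom ≫
        (a.mor ◁ (G.mapComp p.snd (q.snd ≫ r.snd)).hom ≫ (α_ _ _ _).inv ≫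
          p.cell ▷ G.map (q.snd ≫ r.snd) ≫ (α_ _ _ _).hom) ≫
          F.map p.fst ◁ (b.mor ◁ (G.mapComp q.snd r.snd).hom ≫ (α_ _ _ _).inv) =
      (a.mor ◁ (G.mapComp (p.snd ≫ q.snd) r.snd).hom ≫ (α_ _ _ _).inv) ≫
        (a.mor ◁ (G.mapComp p.snd q.snd).hom ≫ (α_ _ _ _).inv ≫ p.cell ▷ G.map q.snd ≫
          (α_ _ _ _).hom) ▷ G.map r.snd ≫ (α_ _ _ _).hom := by
  have h2 : a.mor ◁ G.map p.snd ◁ (G.mapComp q.snd r.snd).inv ≫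
      (α_ _ _ _).inv ≫ p.cell ▷ G.map (q.snd ≫ r.snd) ≫ (α_ _ _ _).hom ≫
      F.map p.fst ◁ b.mor ◁ (G.mapComp q.snd r.snd).hom =
      (α_ _ _ _).inv ≫ p.cell ▷ _ ≫ (α_ _ _ _).hom := by
    rw [associator_inv_naturality_right_assoc, whisker_exchange_assoc,
      associator_naturality_right_assoc, ← whiskerLeft_comp, ← whiskerLeft_comp]
    simp
  simp
  rw [reassoc_of% h2]
  bicategory

theorem mixed_associator'' {a b c d : LaxComma F G} (p : a ⟶ b) (q : b ⟶ c) (r : c ⟶ d) :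
    a.mor ◁ G.map₂ (α_ p.snd q.snd r.snd).hom ≫
        (a.mor ◁ (G.mapComp p.snd (q.snd ≫ r.snd)).hom ≫ (α_ _ _ _).inv ≫
          p.cell ▷ G.map (q.snd ≫ r.snd) ≫ (α_ _ _ _).hom) ≫
          F.map p.fst ◁ (b.mor ◁ (G.mapComp q.snd r.snd).hom ≫ (α_ _ _ _).inv ≫
            q.cell ▷ G.map r.snd ≫ (α_ _ _ _).hom) =
      (a.mor ◁ (G.mapComp (p.snd ≫ q.snd) r.snd).hom ≫ (α_ _ _ _).inv ≫
        (p ≫ q).cell ▷ G.map r.snd ≫ (α_ _ _ _).hom) ≫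
        (F.mapComp p.fst q.fst).hom ▷ (c.mor ≫ G.map r.snd) ≫ (α_ _ _ _).hom := by
  have h2 : a.mor ◁ G.map p.snd ◁ (G.mapComp q.snd r.snd).inv ≫
      (α_ _ _ _).inv ≫ p.cell ▷ G.map (q.snd ≫ r.snd) ≫ (α_ _ _ _).hom ≫
      F.map p.fst ◁ b.mor ◁ (G.mapComp q.snd r.snd).hom =
      (α_ _ _ _).inv ≫ p.cell ▷ _ ≫ (α_ _ _ _).hom := by
    rw [associator_inv_naturality_right_assoc, whisker_exchange_assoc,
      associator_naturality_right_assoc, ← whiskerLeft_comp, ← whiskerLeft_comp]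
    simp
  simp only [comp_cell, whiskerLeft_comp, Category.assoc]
  simp
  rw [reassoc_of% h2]
  bicategory

theorem mixed_leftUnitor {a b : LaxComma F G} (p : a ⟶ b) :
    a.mor ◁ G.map₂ (λ_ p.snd).hom = (a.mor ◁ (G.mapComp (𝟙 a.snd) p.snd).hom ≫ (α_ _ _ _).inv ≫
      (𝟙 a : a ⟶ a).cell ▷ G.map p.snd ≫ (α_ _ _ _).hom) ≫
      (F.mapId a.fst).hom ▷ (a.mor ≫ G.map p.snd) ≫ (λ_ _).hom := by
  simp only [id_cell, Category.assoc]
  simp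

theorem mixed_rightUnitor {a b : LaxComma F G} (p : a ⟶ b) :
    a.mor ◁ G.map₂ (ρ_ p.snd).hom = (a.mor ◁ (G.mapComp p.snd (𝟙 b.snd)).hom ≫ (α_ _ _ _).inv) ≫
      (a.mor ≫ G.map p.snd) ◁ (G.mapId b.snd).hom ≫ (ρ_ _).hom := by
  simp

theorem cylComp_naturality_left {a b c : LaxComma F G} {p p' : a ⟶ b} (η : p ⟶ p') (q : b ⟶ c)
    {e e' e'' : Fin 2} (h : e ≤ e') (h' : e' ≤ e'') :
    cylMap₂ (η ▷ q) (h.trans h') ≫ cylComp p' q h h' = cylComp p q h h' ≫ cylMap₂ η h ▷ cylMap q h' := by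
  induction e, e', h using fin_two_cases₂ with
  | h00 =>
    match e'' with
    | 0 => exact F.toOplax.mapComp_naturality_left η.fst q.fst
    | 1 => exact mixed_naturality_left' η q
  | h01 =>
    obtain rfl : e'' = 1 := le_antisymm (Fin.le_last _) h'
    exact mixed_naturality_left η q
  | h11 =>
    obtain rfl : e'' = 1 := le_antisymm (Fin.le_last _) h'
    exact G.toOplax.mapComp_naturality_left η.snd q.snd

theorem cylComp_naturality_right {a b c : LaxComma F G} (p : a ⟶ b) {q q' : b ⟶ c} (η : q ⟶ q')
    {e e' e'' : Fin 2} (h : e ≤ e') (h' : e' ≤ e'') :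
    cylMap₂ (p ◁ η) (h.trans h') ≫ cylComp p q' h h' = cylComp p q h h' ≫ cylMap p h ◁ cylMap₂ η h' := by
  induction e, e', h using fin_two_cases₂ with
  | h00 =>
    match e'' with
    | 0 => exact F.toOplax.mapComp_naturality_right p.fst η.fst
    | 1 => exact mixed_naturality_right' p η
  | h01 =>
    obtain rfl : e'' = 1 := le_antisymm (Fin.le_last _) h'
    exact mixed_naturality_right p η
  | h11 =>
    obtain rfl : e'' = 1 := le_antisymm (Fin.le_last _) h'
    exact G.toOplax.mapComp_naturality_right p.snd η.snd

theorem cylComp_associator {a b c d : LaxComma F G} (p : a ⟶ b) (q : b ⟶ c) (r : c ⟶ d)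
    {e e' e'' e₃ : Fin 2} (h : e ≤ e') (h' : e' ≤ e'') (h'' : e'' ≤ e₃) :
    cylMap₂ (α_ p q r).hom (h.trans (h'.trans h'')) ≫ cylComp p (q ≫ r) h (h'.trans h'') ≫
        cylMap p h ◁ cylComp q r h' h'' =
      cylComp (p ≫ q) r (h.trans h') h'' ≫ cylComp p q h h' ▷ cylMap r h'' ≫ (α_ _ _ _).hom := by
  induction e, e', h using fin_two_cases₂ with
  | h00 =>
    induction e'', e₃, h'' using fin_two_cases₂ with
    | h00 => exact F.toOplax.map₂_associator p.fst q.fst r.fst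
    | h01 => exact mixed_associator'' p q r
    | h11 => exact mixed_associator' p q r
  | h01 =>
    obtain rfl : e'' = 1 := le_antisymm (Fin.le_last _) h'
    obtain rfl : e₃ = 1 := le_antisymm (Fin.le_last _) h''
    exact mixed_associator p q r
  | h11 =>
    obtain rfl : e'' = 1 := le_antisymm (Fin.le_last _) h'
    obtain rfl : e₃ = 1 := le_antisymm (Fin.le_last _) h''
    exact G.toOplax.map₂_associator p.snd q.snd r.snd

theorem cylComp_leftUnitor {a b : LaxComma F G} (p : a ⟶ b) {e e' : Fin 2} (h : e ≤ e') :
    cylMap₂ (λ_ p).hom h = cylComp (𝟙 a) p le_rfl h ≫ cylId a e ▷ cylMap p h ≫ (λ_ _).hom := by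
  induction e, e', h using fin_two_cases₂ with
  | h00 => exact F.toOplax.map₂_leftUnitor p.fst
  | h01 => exact mixed_leftUnitor p
  | h11 => exact G.toOplax.map₂_leftUnitor p.snd

theorem cylComp_rightUnitor {a b : LaxComma F G} (p : a ⟶ b) {e e' : Fin 2} (h : e ≤ e') :
    cylMap₂ (ρ_ p).hom h = cylComp p (𝟙 b) h le_rfl ≫ cylMap p h ◁ cylId b e' ≫ (ρ_ _).hom := by
  induction e, e', h using fin_two_cases₂ with
  | h00 => exact F.toOplax.map₂_rightUnitor p.fst
  | h01 => exact mixed_rightUnitor p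
  | h11 => exact G.toOplax.map₂_rightUnitor p.snd

theorem cylMap_id (c : LaxComma F G) : ∀ e : Fin 2, cylMap (𝟙 c) (le_refl e) = 𝟙 (cylObj c e)
  | 0 => F.map_id _
  | 1 => G.map_id _

variable (F G) in
/-- The cylinder on the lax comma object, a lax natural transformation between the composites of
its projections with `F` and `G`. -/
def cylinder : NormalOplaxFunctor (LaxComma F G × LocallyDiscrete (Fin 2)) Y where
  obj x := cylObj x.1 x.2.as
  map f := cylMap f.1 (leOfHom f.2.as)
  map₂ {x y f g} η := cylMap₂ η.1 (leOfHom f.2.as)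
  map₂_id f := cylMap₂_id f.1 (leOfHom f.2.as)
  map₂_comp {_ _ f _ _} η θ := cylMap₂_comp η.1 θ.1 (leOfHom f.2.as)
  mapId x := cylId x.1 x.2.as
  mapComp f g := cylComp f.1 g.1 (leOfHom f.2.as) (leOfHom g.2.as)
  mapComp_naturality_left {_ _ _ f _} η g :=
    cylComp_naturality_left η.1 g.1 (leOfHom f.2.as) (leOfHom g.2.as)
  mapComp_naturality_right f g _ η :=
    cylComp_naturality_right f.1 η.1 (leOfHom f.2.as) (leOfHom g.2.as)
  map₂_associator f g h :=
    cylComp_associator f.1 g.1 h.1 (leOfHom f.2.as) (leOfHom g.2.as) (leOfHom h.2.as)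
  map₂_leftUnitor f := cylComp_leftUnitor f.1 (leOfHom f.2.as)
  map₂_rightUnitor f := cylComp_rightUnitor f.1 (leOfHom f.2.as)
  map_id x := cylMap_id x.1 x.2.as
  mapId_eq_eqToHom := by
    rintro ⟨x, ⟨e⟩⟩
    match e with
    | 0 => exact congrArg Iso.hom (F.mapId_eq_eqToIso x.fst)
    | 1 => exact congrArg Iso.hom (G.mapId_eq_eqToIso x.snd)

end LaxComma

/-! ### Projections of the lax comma object -/

namespace LaxComma
variable {X : Type u₁} [Bicategory.{w₁, v₁} X] {Y : Type u₂} [Bicategory.{w₂, v₂} Y]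
  {Z : Type u₃} [Bicategory.{w₃, v₃} Z] (F : StrictPseudofunctor X Y) (G : StrictPseudofunctor Z Y)

/-- The projection of the lax comma object to the domain of `F`. -/
def fstFunctor : NormalOplaxFunctor (LaxComma F G) X where
  obj := LaxComma.fst
  map := Hom.fst
  map₂ := Hom₂.fst
  map₂_id _ := rfl
  map₂_comp _ _ := rfl
  mapId _ := 𝟙 _
  mapComp _ _ := 𝟙 _
  mapComp_naturality_left _ _ := (Category.comp_id _).trans (Category.id_comp _).symm
  mapComp_naturality_right _ _ _ _ := (Category.comp_id _).trans (Category.id_comp _).symm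
  map₂_associator p q r := by
    change (α_ p.fst q.fst r.fst).hom ≫ _ = _
    simp
  map₂_leftUnitor p := by
    change (λ_ p.fst).hom = _
    simp
  map₂_rightUnitor p := by
    change (ρ_ p.fst).hom = _
    simp
  map_id _ := rfl
  mapId_eq_eqToHom _ := rfl

/-- The projection of the lax comma object to the domain of `G`. -/
def sndFunctor : NormalOplaxFunctor (LaxComma F G) Z where
  obj := LaxComma.snd
  map := Hom.snd
  map₂ := Hom₂.snd
  map₂_id _ := rfl
  map₂_comp _ _ := rfl
  mapId _ := 𝟙 _
  mapComp _ _ := 𝟙 _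
  mapComp_naturality_left _ _ := (Category.comp_id _).trans (Category.id_comp _).symm
  mapComp_naturality_right _ _ _ _ := (Category.comp_id _).trans (Category.id_comp _).symm
  map₂_associator p q r := by
    change (α_ p.snd q.snd r.snd).hom ≫ _ = _
    simp
  map₂_leftUnitor p := by
    change (λ_ p.snd).hom = _
    simp
  map₂_rightUnitor p := by
    change (ρ_ p.snd).hom = _
    simp
  map_id _ := rfl
  mapId_eq_eqToHom _ := rfl

variable {F G}

instance isIso_id_cell (a : LaxComma F G) : IsIso (𝟙 a : a ⟶ a).cell :=
  inferInstanceAs (IsIso (a.mor ◁ (G.mapId a.snd).hom ≫ (ρ_ a.mor).hom ≫ (λ_ a.mor).inv ≫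
    (F.mapId a.fst).inv ▷ a.mor))

instance isIso_comp_cell {a b c : LaxComma F G} (p : a ⟶ b) (q : b ⟶ c) [IsIso p.cell]
    [IsIso q.cell] : IsIso (p ≫ q).cell :=
  inferInstanceAs (IsIso (a.mor ◁ (G.mapComp p.snd q.snd).hom ≫
    (α_ a.mor (G.map p.snd) (G.map q.snd)).inv ≫
    p.cell ▷ G.map q.snd ≫
    (α_ (F.map p.fst) b.mor (G.map q.snd)).hom ≫
    F.map p.fst ◁ q.cell ≫
    (α_ (F.map p.fst) (F.map q.fst) c.mor).inv ≫
    (F.mapComp p.fst q.fst).inv ▷ c.mor))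

theorem eqToHom_fst {a b : LaxComma F G} {p q : a ⟶ b} (h : p = q) :
    (eqToHom h).fst = eqToHom (congrArg Hom.fst h) := by subst h; rfl

end LaxComma

/-! ### Biuniversal arrows and lifting to the lax comma object -/

section Biuniversal
variable {A : Type u₁} [Bicategory.{w₁, v₁} A] {Y : Type u₂} [Bicategory.{w₂, v₂} Y]
  {X : Type u₃} [Bicategory.{w₃, v₃} X]

/-- A 1-cell `f : y ⟶ I x` is a biuniversal arrow from `y` to `I` if precomposition with it induces
equivalences `X(x, x') ≃ Y(y, I x')`. -/
structure IsBiuniversal (I : StrictPseudofunctor X Y) {y : Y} {x : X} (f : y ⟶ I.obj x) : Prop where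
  exists_lift : ∀ ⦃x' : X⦄ (g : y ⟶ I.obj x'), ∃ u : x ⟶ x', Nonempty (f ≫ I.map u ≅ g)
  existsUnique_lift₂ : ∀ ⦃x' : X⦄ (u v : x ⟶ x') (φ : f ≫ I.map u ⟶ f ≫ I.map v),
    ∃! χ : u ⟶ v, f ◁ I.map₂ χ = φ

variable {F : StrictPseudofunctor A Y} {I : StrictPseudofunctor X Y}

/-- Since `q.cell` is invertible, the compatibility condition prescribes the whiskering of the
second component with `c.mor`, and biuniversality solves this uniquely. Thus equations between such
2-cells can be checked on first components, and this is how all axioms of `LiftData.lift` are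
proved. -/
theorem IsBiuniversal.existsUnique_hom₂ {c d : LaxComma F I} (hc : IsBiuniversal I c.mor)
    {p q : c ⟶ d} [IsIso q.cell] (θ : p.fst ⟶ q.fst) : ∃! η : p ⟶ q, η.fst = θ := by
  obtain ⟨χ, hχ, huniq⟩ := hc.existsUnique_lift₂ p.snd q.snd
    (p.cell ≫ F.map₂ θ ▷ d.mor ≫ inv q.cell)
  refine ⟨⟨θ, χ, ?_⟩, rfl, ?_⟩
  · rw [hχ]; simp
  · rintro ⟨θ', χ', h⟩ rfl
    obtain rfl : χ' = χ := huniq _ (by dsimp only; rw [reassoc_of% h]; simp)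
    rfl

/-- The lift of a 2-cell to the lax comma object. -/
noncomputable def IsBiuniversal.lift₂ {c d : LaxComma F I} (hc : IsBiuniversal I c.mor)
    {p q : c ⟶ d} [IsIso q.cell] (θ : p.fst ⟶ q.fst) : p ⟶ q := (hc.existsUnique_hom₂ θ).choose

theorem IsBiuniversal.lift₂_fst {c d : LaxComma F I} (hc : IsBiuniversal I c.mor)
    {p q : c ⟶ d} [IsIso q.cell] (θ : p.fst ⟶ q.fst) : (hc.lift₂ θ).fst = θ :=
  (hc.existsUnique_hom₂ θ).choose_spec.1

theorem IsBiuniversal.hom₂_ext {c d : LaxComma F I} (hc : IsBiuniversal I c.mor)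
    {p q : c ⟶ d} [IsIso q.cell] {η η' : p ⟶ q} (h : η.fst = η'.fst) : η = η' :=
  (hc.existsUnique_hom₂ η'.fst).unique h rfl

variable (F I) in
/-- The data needed to lift a normal oplax functor to the lax comma object: biuniversal lifts of the
objects and normalized lifts of the 1-cells. -/
structure LiftData {B : Type u} [Bicategory.{w, v} B] (G : NormalOplaxFunctor B A) where
  obj : B → X
  mor (b : B) : F.obj (G.obj b) ⟶ I.obj (obj b)
  isBiuniversal (b : B) : IsBiuniversal I (mor b)
  map {b b' : B} (p : b ⟶ b') : obj b ⟶ obj b'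
  cell {b b' : B} (p : b ⟶ b') : mor b ≫ I.map (map p) ≅ F.map (G.map p) ≫ mor b'
  hom_id (b : B) : LaxComma.Hom.mk (G.map (𝟙 b)) (map (𝟙 b)) (cell (𝟙 b)).hom =
    𝟙 (LaxComma.mk (G.obj b) (obj b) (mor b) : LaxComma F I)

namespace LiftData
variable {B : Type u} [Bicategory.{w, v} B] {G : NormalOplaxFunctor B A} (D : LiftData F I G)

/-- The lift of an object. -/
abbrev liftObj (b : B) : LaxComma F I := ⟨G.obj b, D.obj b, D.mor b⟩

/-- The lift of a 1-cell. -/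
abbrev liftMap {b b' : B} (p : b ⟶ b') : D.liftObj b ⟶ D.liftObj b' :=
  LaxComma.Hom.mk (G.map p) (D.map p) (D.cell p).hom

theorem liftObj_isBiuniversal (b : B) : IsBiuniversal I (D.liftObj b).mor := D.isBiuniversal b

instance {b b' : B} (p : b ⟶ b') : IsIso (D.liftMap p).cell := (D.cell p).isIso_hom

instance (b : B) : IsIso (𝟙 (D.liftObj b) : D.liftObj b ⟶ D.liftObj b).cell :=
  LaxComma.isIso_id_cell _

instance {b b' b'' : B} (p : b ⟶ b') (q : b' ⟶ b'') : IsIso (D.liftMap p ≫ D.liftMap q).cell :=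
  LaxComma.isIso_comp_cell _ _

instance {b₀ b₁ b₂ b₃ : B} (p : b₀ ⟶ b₁) (q : b₁ ⟶ b₂) (r : b₂ ⟶ b₃) :
    IsIso (D.liftMap p ≫ D.liftMap q ≫ D.liftMap r).cell :=
  LaxComma.isIso_comp_cell _ _

theorem liftMap_id (b : B) : D.liftMap (𝟙 b) = 𝟙 (D.liftObj b) := D.hom_id b

/-- The lift of a 2-cell between the images of lifted 1-cells. -/
noncomputable abbrev lift₂ {b : B} {d : LaxComma F I} {p q : D.liftObj b ⟶ d} [IsIso q.cell]
    (θ : p.fst ⟶ q.fst) : p ⟶ q := (D.liftObj_isBiuniversal b).lift₂ θ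

theorem lift₂_fst {b : B} {d : LaxComma F I} {p q : D.liftObj b ⟶ d} [IsIso q.cell]
    (θ : p.fst ⟶ q.fst) : (D.lift₂ θ).fst = θ := IsBiuniversal.lift₂_fst _ _

theorem hom₂_ext {b : B} {d : LaxComma F I} {p q : D.liftObj b ⟶ d} [IsIso q.cell]
    {η η' : p ⟶ q} (h : η.fst = η'.fst) : η = η' := (D.liftObj_isBiuniversal b).hom₂_ext h

/-- The lift of the unit constraint. -/
noncomputable def liftId (b : B) : D.liftMap (𝟙 b) ⟶ 𝟙 (D.liftObj b) :=
  D.lift₂ (p := D.liftMap (𝟙 b)) (q := 𝟙 (D.liftObj b)) (G.mapId b)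

theorem liftId_fst (b : B) : (D.liftId b).fst = G.mapId b := D.lift₂_fst _

/-- The lift of the composition constraint. -/
noncomputable def liftComp {b b' b'' : B} (p : b ⟶ b') (q : b' ⟶ b'') :
    D.liftMap (p ≫ q) ⟶ D.liftMap p ≫ D.liftMap q :=
  D.lift₂ (p := D.liftMap (p ≫ q)) (q := D.liftMap p ≫ D.liftMap q) (G.mapComp p q)

theorem liftComp_fst {b b' b'' : B} (p : b ⟶ b') (q : b' ⟶ b'') :
    (D.liftComp p q).fst = G.mapComp p q := D.lift₂_fst _

/-- The lifted normal oplax functor. -/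
noncomputable def lift : NormalOplaxFunctor B (LaxComma F I) where
  obj := D.liftObj
  map := D.liftMap
  map₂ {_ _ p q} η := D.lift₂ (p := D.liftMap p) (q := D.liftMap q) (G.map₂ η)
  map₂_id p := D.hom₂_ext ((D.lift₂_fst _).trans (G.map₂_id p))
  map₂_comp η θ := D.hom₂_ext (by
    rw [LaxComma.comp₂_fst, D.lift₂_fst, D.lift₂_fst, D.lift₂_fst]
    exact G.map₂_comp η θ)
  mapId b := D.liftId b
  mapComp p q := D.liftComp p q
  mapComp_naturality_left η g := D.hom₂_ext (by
    rw [LaxComma.comp₂_fst, LaxComma.comp₂_fst, LaxComma.whiskerRight_fst]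
    simp only [D.lift₂_fst, D.liftComp_fst]
    exact G.mapComp_naturality_left η g)
  mapComp_naturality_right f _ _ η := D.hom₂_ext (by
    rw [LaxComma.comp₂_fst, LaxComma.comp₂_fst, LaxComma.whiskerLeft_fst]
    simp only [D.lift₂_fst, D.liftComp_fst]
    exact G.mapComp_naturality_right f η)
  map₂_associator f g h := D.hom₂_ext (by
    simp only [LaxComma.comp₂_fst, LaxComma.whiskerLeft_fst, LaxComma.whiskerRight_fst, D.lift₂_fst,
      D.liftComp_fst]
    exact G.map₂_associator f g h)
  map₂_leftUnitor f := D.hom₂_ext (by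
    simp only [LaxComma.comp₂_fst, LaxComma.whiskerRight_fst, D.lift₂_fst,
      D.liftComp_fst, D.liftId_fst]
    exact G.map₂_leftUnitor f)
  map₂_rightUnitor f := D.hom₂_ext (by
    simp only [LaxComma.comp₂_fst, LaxComma.whiskerLeft_fst, D.lift₂_fst,
      D.liftComp_fst, D.liftId_fst]
    exact G.map₂_rightUnitor f)
  map_id := D.liftMap_id
  mapId_eq_eqToHom b := D.hom₂_ext (by
    rw [D.liftId_fst, LaxComma.eqToHom_fst, G.mapId_eq_eqToHom]
    rfl)

end LiftData

end Biuniversal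

/-! ### Choosing normalized lifts -/

section
variable {A : Type u₁} [Bicategory.{w₁, v₁} A] {Y : Type u₂} [Bicategory.{w₂, v₂} Y]
  {X : Type u₃} [Bicategory.{w₃, v₃} X] {F : StrictPseudofunctor A Y} {I : StrictPseudofunctor X Y}

/-- The chosen lift of an identity must be the identity on the nose, because simplices of the nerve
are normal. The end points `c` and `c'` are independent variables, so that one choice serves all
1-cells; hence the heterogeneous equalities. -/
theorem IsBiuniversal.exists_normalized {c c' : LaxComma F I} (hc : IsBiuniversal I c.mor)
    (p : c.fst ⟶ c'.fst) : ∃ (u : c.snd ⟶ c'.snd) (θ : c.mor ≫ I.map u ≅ F.map p ≫ c'.mor),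
      c = c' → HEq p (𝟙 c.fst) → HEq (LaxComma.Hom.mk p u θ.hom) (𝟙 c) := by
  by_cases h : c = c' ∧ HEq p (𝟙 c.fst)
  · obtain ⟨rfl, h⟩ := h
    obtain rfl := eq_of_heq h
    exact ⟨𝟙 _, @asIso _ _ _ _ (𝟙 c : c ⟶ c).cell (LaxComma.isIso_id_cell c), fun _ _ => HEq.rfl⟩
  · obtain ⟨u, ⟨θ⟩⟩ := hc.exists_lift (F.map p ≫ c'.mor)
    exact ⟨u, θ, fun h₁ h₂ => absurd ⟨h₁, h₂⟩ h⟩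

theorem IsBiuniversal.nonempty_liftData
    (h : ∀ y, ∃ (x : X) (f : y ⟶ I.obj x), IsBiuniversal I f) :
    Nonempty (LiftData (StrictPseudofunctor.id Y) I (ofStrict (StrictPseudofunctor.id Y))) := by
  choose r η hη using h
  let c (y : Y) : LaxComma (StrictPseudofunctor.id Y) I := ⟨y, r y, η y⟩
  choose u θ hu using fun (y y' : Y) (p : y ⟶ y') =>
    IsBiuniversal.exists_normalized (c := c y) (c' := c y') (hη y) p
  exact ⟨{
    obj := r
    mor := η
    isBiuniversal := hη
    map p := u _ _ p
    cell p := θ _ _ p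
    hom_id y := eq_of_heq (hu y y (𝟙 y) rfl HEq.rfl) }⟩

end

namespace LaxComma
variable {A : Type u₁} [Bicategory.{w₁, v₁} A] {Y : Type u₂} [Bicategory.{w₂, v₂} Y]
  {X : Type u₃} [Bicategory.{w₃, v₃} X] {F : StrictPseudofunctor A Y} {I : StrictPseudofunctor X Y}

theorem pair_zero_comp_cylinder {n : ℕ}
    (S : NormalOplaxFunctor (LocallyDiscrete (Fin (n + 1))) (LaxComma F I)) :
    (S.pair (OrderHom.const _ 0)).comp (cylinder F I) =
      (S.comp (fstFunctor F I)).comp (ofStrict F) :=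
  ext_of_isLocallyDiscrete (fun _ => rfl) (fun _ _ _ => HEq.rfl) fun _ _ _ _ _ => heq_of_eq
    (congrArg (fun t => F.map₂ t ≫ (F.mapComp _ _).hom) (Category.comp_id _).symm)

theorem pair_one_comp_cylinder {n : ℕ}
    (S : NormalOplaxFunctor (LocallyDiscrete (Fin (n + 1))) (LaxComma F I)) :
    (S.pair (OrderHom.const _ 1)).comp (cylinder F I) =
      (S.comp (sndFunctor F I)).comp (ofStrict I) :=
  ext_of_isLocallyDiscrete (fun _ => rfl) (fun _ _ _ => HEq.rfl) fun _ _ _ _ _ => heq_of_eq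
    (congrArg (fun t => I.map₂ t ≫ (I.mapComp _ _).hom) (Category.comp_id _).symm)

end LaxComma

theorem NormalOplaxFunctor.comp_assoc {B : Type u} [Bicategory.{w, v} B] [IsLocallyDiscrete B]
    {C : Type u₁} [Bicategory.{w₁, v₁} C] {C' : Type u₂} [Bicategory.{w₂, v₂} C']
    {C'' : Type u₃} [Bicategory.{w₃, v₃} C''] (S : NormalOplaxFunctor B C)
    (H : NormalOplaxFunctor C C') (H' : NormalOplaxFunctor C' C'') :
    (S.comp H).comp H' = S.comp (H.comp H') :=
  ext_of_isLocallyDiscrete (fun _ => rfl) (fun _ _ _ => HEq.rfl) fun _ _ _ _ _ => heq_of_eq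
    ((congrArg (fun t => t ≫ H'.mapComp _ _) (H'.map₂_comp _ _)).trans (Category.assoc _ _ _))

theorem NormalOplaxFunctor.comp_ofStrict_id {B : Type u₁} [Bicategory.{w₁, v₁} B]
    [IsLocallyDiscrete B] {C : Type u₂} [Bicategory.{w₂, v₂} C] (S : NormalOplaxFunctor B C) :
    S.comp (ofStrict (StrictPseudofunctor.id C)) = S :=
  ext_of_isLocallyDiscrete (fun _ => rfl) (fun _ _ _ => HEq.rfl) fun _ _ _ _ _ => heq_of_eq
    (Category.comp_id _)

theorem LiftData.comp_lift_comp_fst {A : Type u₁} [Bicategory.{w₁, v₁} A] {Y : Type u₂}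
    [Bicategory.{w₂, v₂} Y] {X : Type u₃} [Bicategory.{w₃, v₃} X] {F : StrictPseudofunctor A Y}
    {I : StrictPseudofunctor X Y} {B : Type u} [Bicategory.{w, v} B] {G : NormalOplaxFunctor B A}
    (D : LiftData F I G) {n : ℕ} (S : NormalOplaxFunctor (LocallyDiscrete (Fin (n + 1))) B) :
    (S.comp D.lift).comp (LaxComma.fstFunctor F I) = S.comp G := by
  refine ext_of_isLocallyDiscrete (fun _ => rfl) (fun _ _ _ => HEq.rfl)
    fun a b c f g => heq_of_eq ?_
  change (D.lift₂ (p := D.liftMap (S.map (f ≫ g))) (q := D.liftMap (S.map f ≫ S.map g))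
    (G.map₂ (S.mapComp f g)) ≫ D.liftComp (S.map f) (S.map g)).fst ≫ 𝟙 _ =
    G.map₂ (S.mapComp f g) ≫ G.mapComp (S.map f) (S.map g)
  rw [Category.comp_id, LaxComma.comp₂_fst, D.lift₂_fst, D.liftComp_fst]
  rfl

/-! ### The reflection and the homotopies of its unit and counit -/

section
variable {X Y : Type u} [Bicategory.{u, u} X] [Bicategory.{u, u} Y] {I : StrictPseudofunctor X Y}

namespace LiftData
variable (D : LiftData (StrictPseudofunctor.id Y) I (ofStrict (StrictPseudofunctor.id Y)))

/-- The reflection of `Y` into `X` given by biuniversal arrows. -/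
noncomputable def reflection : NormalOplaxFunctor Y X := D.lift.comp (LaxComma.sndFunctor _ _)

theorem lift_comp_fst :
    oplaxNerveMap D.lift ≫ oplaxNerveMap (LaxComma.fstFunctor _ _) = 𝟙 (oplaxNerve Y) := by
  ext n S
  exact (D.comp_lift_comp_fst S).trans (comp_ofStrict_id S)

/-- The unit of the reflection induces a homotopy. -/
theorem unit_homotopic :
    (SSet.toTop.map (𝟙 (oplaxNerve Y))).hom.Homotopic
      (SSet.toTop.map (oplaxNerveMap D.reflection ≫ oplaxNerveMap (ofStrict I))).hom := by
  have h : (SSet.toTop.map (oplaxNerveMap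
      (LaxComma.fstFunctor (StrictPseudofunctor.id Y) I))).hom.Homotopic
      (SSet.toTop.map (oplaxNerveMap (LaxComma.sndFunctor (StrictPseudofunctor.id Y) I) ≫
        oplaxNerveMap (ofStrict I))).hom :=
    homotopic_of_cylinder (LaxComma.cylinder _ _)
      (fun n S => (LaxComma.pair_zero_comp_cylinder S).trans (comp_ofStrict_id _))
      (fun n S => LaxComma.pair_one_comp_cylinder S)
  -- Restricting the universal cylinder along the section `D.lift` turns the first projection into
  -- the identity and the second into the reflection.
  have h' := h.comp (ContinuousMap.Homotopic.refl (SSet.toTop.map (oplaxNerveMap D.lift)).hom)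
  rw [← D.lift_comp_fst, SSet.toTop.map_comp]
  have e : oplaxNerveMap D.reflection ≫ oplaxNerveMap (ofStrict I) =
    oplaxNerveMap D.lift ≫ oplaxNerveMap (LaxComma.sndFunctor (StrictPseudofunctor.id Y) I) ≫
        oplaxNerveMap (ofStrict I) := by
    ext n S
    exact congrArg (fun T => T.comp (ofStrict I)) (comp_assoc S D.lift (LaxComma.sndFunctor _ _)).symm
  rw [e, SSet.toTop.map_comp (oplaxNerveMap D.lift)]
  exact h'

variable (hI : ∀ x, IsBiuniversal I (𝟙 (I.obj x)))

/-- The objects of the cylinder between the identity and the reflection of `I`. -/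
def counitObj (x : X) : Fin 2 → X
  | 0 => x
  | 1 => D.obj (I.obj x)

/-- The biuniversal arrows of the cylinder between the identity and the reflection of `I`. -/
def counitMor (x : X) : ∀ e : Fin 2, I.obj x ⟶ I.obj (D.counitObj x e)
  | 0 => 𝟙 _
  | 1 => D.mor (I.obj x)

include hI in
theorem counitMor_isBiuniversal (x : X) : ∀ e, IsBiuniversal I (D.counitMor x e)
  | 0 => hI x
  | 1 => D.isBiuniversal _

/-- The 1-cells of the cylinder between the identity and the reflection of `I`. -/
noncomputable def counitMap {x x' : X} (p : x ⟶ x') :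
    ∀ e e' : Fin 2, D.counitObj x e ⟶ D.counitObj x' e'
  -- The diagonal values are prescribed, so that the two ends of the cylinder are exactly the
  -- identity and the reflection of `I`.
  | 0, 0 => p
  | 0, 1 => ((D.counitMor_isBiuniversal hI x 0).exists_lift (I.map p ≫ D.counitMor x' 1)).choose
  -- There is no arrow from `1` to `0` in `[1]`; this value only makes the function total.
  | 1, 0 => ((D.counitMor_isBiuniversal hI x 1).exists_lift (I.map p ≫ D.counitMor x' 0)).choose
  | 1, 1 => D.map (I.map p)

/-- The 2-cells over the 1-cells of the cylinder between the identity and the reflection of `I`. -/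
noncomputable def counitCell {x x' : X} (p : x ⟶ x') : ∀ e e' : Fin 2,
    D.counitMor x e ≫ I.map (D.counitMap hI p e e') ≅ I.map p ≫ D.counitMor x' e'
  | 0, 0 => λ_ (I.map p) ≪≫ (ρ_ (I.map p)).symm
  | 0, 1 => ((D.counitMor_isBiuniversal hI x 0).exists_lift
      (I.map p ≫ D.counitMor x' 1)).choose_spec.some
  | 1, 0 => ((D.counitMor_isBiuniversal hI x 1).exists_lift
      (I.map p ≫ D.counitMor x' 0)).choose_spec.some
  | 1, 1 => D.cell (I.map p)

theorem mk_counitCell_id (x : X) : ∀ e : Fin 2,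
    (LaxComma.Hom.mk (I.map (𝟙 x)) (D.counitMap hI (𝟙 x) e e) (D.counitCell hI (𝟙 x) e e).hom :
      LaxComma.Hom (F := StrictPseudofunctor.id Y) (G := I)
        ⟨I.obj x, D.counitObj x e, D.counitMor x e⟩ ⟨I.obj x, D.counitObj x e, D.counitMor x e⟩) =
    𝟙 (⟨I.obj x, D.counitObj x e, D.counitMor x e⟩ : LaxComma (StrictPseudofunctor.id Y) I)
  | 0 => by
    refine LaxComma.hom_eq (I.map_id x) rfl ?_
    rw [LaxComma.id_cell, I.mapId_eq_eqToIso]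
    change ((λ_ (I.map (𝟙 x))).hom ≫ (ρ_ (I.map (𝟙 x))).inv) ≫ (eqToHom (I.map_id x)) ▷ 𝟙 _ =
      𝟙 _ ◁ I.map₂ (𝟙 _) ≫ 𝟙 _ ◁ eqToHom (I.map_id x) ≫ (ρ_ (𝟙 _)).hom ≫ (λ_ (𝟙 _)).inv ≫ 𝟙 _ ▷ 𝟙 _
    rw [I.map₂_id]
    generalize I.map (𝟙 x) = f, I.map_id x = hf
    subst hf
    simp [unitors_equal]
  | 1 => by
    change D.liftMap (I.map (𝟙 x)) = 𝟙 (D.liftObj (I.obj x))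
    rw [I.map_id]
    exact D.liftMap_id _

/-- The data of the cylinder between the identity and the reflection of `I`. -/
noncomputable def counit : LiftData (StrictPseudofunctor.id Y) I
    ((ofStrict (Bicategory.Prod.fst X (LocallyDiscrete (Fin 2)))).comp (ofStrict I)) where
  obj b := D.counitObj b.1 b.2.as
  mor b := D.counitMor b.1 b.2.as
  isBiuniversal b := D.counitMor_isBiuniversal hI b.1 b.2.as
  map {b b'} p := D.counitMap hI p.1 b.2.as b'.2.as
  cell {b b'} p := D.counitCell hI p.1 b.2.as b'.2.as
  hom_id b := D.mk_counitCell_id hI b.1 b.2.as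

/-- At level `0` the biuniversal arrows are identities, so `σ` together with its image under `I` is
already a 2-cell of the comma object; uniqueness of lifts identifies it with `η`. -/
theorem counit_snd_eq {x y z : X} {p : x ⟶ z} {q : x ⟶ y} {r : y ⟶ z} (σ : p ⟶ q ≫ r)
    (η : (D.counit hI).liftMap (b := (x, ⟨0⟩)) (b' := (z, ⟨0⟩)) (p, 𝟙 _) ⟶
      (D.counit hI).liftMap (b := (x, ⟨0⟩)) (b' := (y, ⟨0⟩)) (q, 𝟙 _) ≫
        (D.counit hI).liftMap (b := (y, ⟨0⟩)) (b' := (z, ⟨0⟩)) (r, 𝟙 _))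
    (h : η.fst = I.map₂ σ ≫ (I.mapComp q r).hom) : η.snd = σ := by
  have w : ((λ_ (I.map p)).hom ≫ (ρ_ (I.map p)).inv) ≫
      (I.map₂ σ ≫ (I.mapComp q r).hom) ▷ 𝟙 (I.obj z) =
      𝟙 (I.obj x) ◁ I.map₂ σ ≫ 𝟙 (I.obj x) ◁ (I.mapComp q r).hom ≫ (α_ _ _ _).inv ≫
        ((λ_ (I.map q)).hom ≫ (ρ_ (I.map q)).inv) ▷ I.map r ≫ (α_ _ _ _).hom ≫
        I.map q ◁ ((λ_ (I.map r)).hom ≫ (ρ_ (I.map r)).inv) ≫ (α_ _ _ _).inv ≫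
        𝟙 (I.map q ≫ I.map r) ▷ 𝟙 (I.obj z) := by
    simp
  have e := (D.counit hI).hom₂_ext (η := η)
    (η' := LaxComma.Hom₂.mk (I.map₂ σ ≫ (I.mapComp q r).hom) σ w) h
  exact congrArg LaxComma.Hom₂.snd e

theorem pair_zero_comp_counit {n : ℕ} (S : NormalOplaxFunctor (LocallyDiscrete (Fin (n + 1))) X) :
    ((S.pair (OrderHom.const _ 0)).comp (D.counit hI).lift).comp (LaxComma.sndFunctor _ _) = S := by
  refine ext_of_isLocallyDiscrete (fun _ => rfl) (fun _ _ _ => HEq.rfl)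
    fun a b c f g => heq_of_eq ?_
  refine (Category.comp_id _).trans (D.counit_snd_eq hI (S.mapComp f g) _ ?_)
  exact (congrArg₂ (fun s t => s ≫ t) ((D.counit hI).lift₂_fst _)
    ((D.counit hI).liftComp_fst _ _)).trans (congrArg (fun t => I.map₂ (S.mapComp f g) ≫ t)
      ((congrArg (fun t => t ≫ (I.mapComp _ _).hom) (I.map₂_id _)).trans (Category.id_comp _)))

/-- At level `1` the chosen data are those of `D` by definition, so only composition constraints are
compared, and these are determined by their first components. -/
theorem pair_one_comp_counit {n : ℕ} (S : NormalOplaxFunctor (LocallyDiscrete (Fin (n + 1))) X) :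
    (S.pair (OrderHom.const _ 1)).comp (D.counit hI).lift = (S.comp (ofStrict I)).comp D.lift := by
  refine ext_of_isLocallyDiscrete (fun _ => rfl) (fun _ _ _ => HEq.rfl)
    fun a b c f g => heq_of_eq (D.hom₂_ext
      (p := D.liftMap (I.map (S.map (f ≫ g))))
      (q := D.liftMap (I.map (S.map f)) ≫ D.liftMap (I.map (S.map g))) ?_)
  refine (congrArg₂ (fun s t => s ≫ t) ((D.counit hI).lift₂_fst _)
    ((D.counit hI).liftComp_fst _ _)).trans ?_
  refine Eq.trans ?_ (congrArg₂ (fun s t => s ≫ t) (D.lift₂_fst _) (D.liftComp_fst _ _)).symm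
  change I.map₂ (S.mapComp f g) ≫ I.map₂ (𝟙 _) ≫ (I.mapComp _ _).hom =
    (I.map₂ (S.mapComp f g) ≫ (I.mapComp _ _).hom) ≫ 𝟙 _
  rw [I.map₂_id, Category.id_comp, Category.comp_id]

include hI in
/-- The counit of the reflection induces a homotopy. -/
theorem counit_homotopic :
    (SSet.toTop.map (𝟙 (oplaxNerve X))).hom.Homotopic
      (SSet.toTop.map (oplaxNerveMap (ofStrict I) ≫ oplaxNerveMap D.reflection)).hom :=
  homotopic_of_cylinder ((D.counit hI).lift.comp (LaxComma.sndFunctor _ _))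
    (fun _ S => (comp_assoc _ _ _).symm.trans (D.pair_zero_comp_counit hI S))
    (fun _ S => ((comp_assoc _ _ _).symm.trans (congrArg
      (fun T => T.comp (LaxComma.sndFunctor _ _)) (D.pair_one_comp_counit hI S))).trans
      (comp_assoc _ _ _))

end LiftData

/-- A 2-functor `I : X ⟶ Y` with biuniversal arrows that is locally an equivalence induces a homotopy
equivalence of classifying spaces. -/
theorem isHomotopyEquivalence_of_isBiuniversal
    (h : ∀ y, ∃ (x : X) (f : y ⟶ I.obj x), IsBiuniversal I f)
    (hI : ∀ x, IsBiuniversal I (𝟙 (I.obj x))) : IsHomotopyEquivalence (classifyingMap I) := by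
  obtain ⟨D⟩ := IsBiuniversal.nonempty_liftData h
  refine ⟨{
    toFun := classifyingMap I
    invFun := (SSet.toTop.map (oplaxNerveMap D.reflection)).hom
    left_inv := ?_
    right_inv := ?_ }, rfl⟩
  · have := (D.counit_homotopic hI).symm
    rw [SSet.toTop.map_comp, SSet.toTop.map_id] at this
    exact this
  · have := D.unit_homotopic.symm
    rw [SSet.toTop.map_comp, SSet.toTop.map_id] at this
    exact this

end

/-! ### Transport along equalities of objects -/

section
variable {L : Type u} [Bicategory.{w, v} L]

theorem whiskerRight_eqToHom_injective {a b b' : L} (e : b = b') {f g : a ⟶ b} {η θ : f ⟶ g}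
    (h : η ▷ eqToHom e = θ ▷ eqToHom e) : η = θ := by
  subst e
  exact (Bicategory.whiskerRight_iff η θ).1 h

theorem exists_iso_whiskerRight_eqToHom {a b b' : L} (e : b = b') {f g : a ⟶ b}
    (κ : f ≫ eqToHom e ≅ g ≫ eqToHom e) : ∃ α : f ≅ g, α.hom ▷ eqToHom e = κ.hom := by
  subst e
  change f ≫ 𝟙 b ≅ g ≫ 𝟙 b at κ
  exact ⟨(ρ_ f).symm ≪≫ κ ≪≫ ρ_ g, by simp⟩

theorem exists_heq_hom {a a' b b' : L} (ha : a = a') (hb : b = b') (f : a' ⟶ b') :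
    ∃ g : a ⟶ b, HEq g f := by
  subst ha hb; exact ⟨f, HEq.rfl⟩

theorem exists_heq_hom₂ {a a' b b' : L} (ha : a = a') (hb : b = b') {f g : a ⟶ b}
    {f' g' : a' ⟶ b'} (hf : HEq f f') (hg : HEq g g') (η : f' ⟶ g') :
    ∃ θ : f ⟶ g, HEq θ η := by
  subst ha hb hf hg; exact ⟨η, HEq.rfl⟩

theorem whiskerLeft_injective_of_iso {a b : L} {i : a ⟶ a} (e : i ≅ 𝟙 a) {f g : a ⟶ b} {η θ : f ⟶ g}
    (h : i ◁ η = i ◁ θ) : η = θ := by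
  have h' := congrArg (fun t => e.inv ▷ f ≫ t ≫ e.hom ▷ g) h
  simp only [← whisker_exchange_assoc] at h'
  simpa using h'

end

/-! ### Cartesian 2-cells and opcartesian 1-cells -/

section Opfib
variable {K : Type u₁} [Bicategory.{w₁, v₁} K] {L : Type u₂} [Bicategory.{w₂, v₂} L]
  {P : StrictPseudofunctor K L}

theorem IsCartesian₂.isIso {x y : K} {g h : x ⟶ y} {γ : g ⟶ h} (hγ : IsCartesian₂ P γ)
    [IsIso (P.map₂ γ)] : IsIso γ := by
  obtain ⟨χ, ⟨hχ, hχ'⟩, -⟩ := hγ h (𝟙 h) (inv (P.map₂ γ)) (by simp)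
  refine ⟨χ, (hγ g γ (𝟙 _) (by simp)).unique ⟨?_, ?_⟩ ⟨by simp, by simp⟩, hχ'⟩
  · simp [hχ]
  · simp [hχ']

/-- In the presence of a local fibration, lifts along opcartesian 1-cells can be chosen to lie
strictly over the given 1-cell. -/
theorem IsOpcartesian.exists_strict_lift {a d : K} {h : a ⟶ d} (hh : IsOpcartesian P h)
    (hP : IsLocalFibration P) {b : K} (u : a ⟶ b) (t : P.obj d ⟶ P.obj b)
    (α : P.map h ≫ t ≅ P.map u) : ∃ (s : d ⟶ b) (e : P.map s = t) (top : h ≫ s ≅ u),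
      α.hom = P.map h ◁ eqToHom e.symm ≫ (P.mapComp h s).inv ≫ P.map₂ top.hom := by
  obtain ⟨s, base, top, fac⟩ := hh.exists_lift u t α
  -- A cartesian 2-cell over an invertible one is invertible, so replacing `s` by `s'` only changes
  -- the lift by an isomorphism and absorbs `base` into `top`.
  obtain ⟨s', γ, e, hγ, hγ'⟩ := hP s t base.hom
  have : IsIso (P.map₂ γ) := by rw [hγ]; infer_instance
  have := hγ'.isIso
  refine ⟨s', e, whiskerLeftIso h (asIso γ) ≪≫ top, ?_⟩
  subst e
  rw [fac]
  simp at hγ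
  simp [← hγ]

theorem isOpcartesian_id (a : K) : IsOpcartesian P (𝟙 a) where
  exists_lift b u t α := ⟨{
    hom := u
    base := (λ_ t).symm ≪≫ whiskerRightIso (P.mapId a).symm t ≪≫ α
    top := λ_ u
    fac := by
      have e : (P.mapComp (𝟙 a) u).inv ≫ P.map₂ (λ_ u).hom =
        (P.mapId a).hom ▷ P.map u ≫ (λ_ (P.map u)).hom := by simp
      rw [e, whisker_exchange_assoc]
      simp }⟩
  existsUnique_lift₂ b u u' t t' α α' T T' β ρ h := by
    -- Whiskering with an identity is bijective on 2-cells, so the condition on `top` alone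
    -- determines the lift. The condition on `base` is then checked after whiskering with `P.map (𝟙
    -- a)`, which is isomorphic to an identity.
    obtain ⟨σ, hσ⟩ : ∃ σ : T.hom ⟶ T'.hom, 𝟙 a ◁ σ = T.top.hom ≫ ρ ≫ T'.top.inv :=
      ⟨(λ_ _).inv ≫ (T.top.hom ≫ ρ ≫ T'.top.inv) ≫ (λ_ _).hom, by simp⟩
    refine ⟨σ, ⟨?_, by simp [hσ]⟩, ?_⟩
    · apply whiskerLeft_injective_of_iso (P.mapId a)
      rw [T.fac, T'.fac] at h
      have hσ' := congrArg P.map₂ hσ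
      rw [P.map₂_whisker_left, PrelaxFunctor.map₂_comp, PrelaxFunctor.map₂_comp] at hσ'
      have h' := congrArg (fun t => t ≫ P.map₂ T'.top.inv ≫ (P.mapComp (𝟙 a) T'.hom).hom) h
      simp only [Category.assoc, ← reassoc_of% hσ'] at h'
      simpa [← PrelaxFunctor.map₂_comp_assoc] using h'
    · rintro β' ⟨-, h'⟩
      apply whiskerLeft_injective_of_iso (Iso.refl (𝟙 a))
      rw [hσ, reassoc_of% h']
      simp

end Opfib

/-! ### Biuniversal arrows into the strict pullback -/

namespace StrictPullback
variable {K : Type u₁} [Bicategory.{w₁, v₁} K] {L : Type u₂} [Bicategory.{w₂, v₂} L]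
  {J : Type u₃} [Bicategory.{w₃, v₃} J] [Strict K] [Strict L] [Strict J]
  {P : StrictPseudofunctor K L} {F : StrictPseudofunctor J L} {x : K} {a a' : StrictPullback P F}
  {f : P.obj x ⟶ F.obj a.snd} {h : x ⟶ a.fst} (g : f ≫ F.map (𝟙 a.snd) ≅ P.map h ≫ eqToHom a.w)

/-- The invertible 2-cell obtained by pasting `g` and the identity between `F t` and `t'`. -/
def paste {t : a.snd ⟶ a'.snd} {t' : P.obj a.fst ⟶ P.obj a'.fst} (ht : HEq t' (F.map t)) :
    f ≫ F.map (𝟙 a.snd ≫ t) ≅ (P.map h ≫ t') ≫ eqToHom a'.w :=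
  whiskerLeftIso f (F.mapComp (𝟙 a.snd) t) ≪≫ (α_ _ _ _).symm ≪≫ whiskerRightIso g (F.map t) ≪≫
    α_ _ _ _ ≪≫ whiskerLeftIso (P.map h) (eqToIso (eqToHom_comp_eq a.w a'.w ht)) ≪≫ (α_ _ _ _).symm

theorem paste_naturality {t₁ t₂ : a.snd ⟶ a'.snd} {t₁' t₂' : P.obj a.fst ⟶ P.obj a'.fst}
    (h₁ : HEq t₁' (F.map t₁)) (h₂ : HEq t₂' (F.map t₂)) {γ : t₁ ⟶ t₂} {β : t₁' ⟶ t₂'}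
    (hγ : HEq β (F.map₂ γ)) : f ◁ F.map₂ (𝟙 a.snd ◁ γ) ≫ (paste g h₂).hom =
      (paste g h₁).hom ≫ (P.map h ◁ β) ▷ eqToHom a'.w := by
  have e := congrArg (fun t => P.map h ◁ t) (eqToHom_naturality a.w a'.w h₁ h₂ hγ)
  simp only [whiskerLeft_comp] at e
  have e' : f ◁ F.map₂ (𝟙 a.snd ◁ γ) ≫ f ◁ (F.mapComp (𝟙 a.snd) t₂).hom =
      f ◁ (F.mapComp (𝟙 a.snd) t₁).hom ≫ f ◁ F.map (𝟙 a.snd) ◁ F.map₂ γ := by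
    rw [F.map₂_whisker_left, ← whiskerLeft_comp, ← whiskerLeft_comp]
    simp only [Category.assoc, Iso.inv_hom_id, Category.comp_id]
  simp only [paste, Iso.trans_hom, Iso.symm_hom, whiskerLeftIso_hom, whiskerRightIso_hom,
    eqToIso.hom, Category.assoc]
  rw [reassoc_of% e', associator_inv_naturality_right_assoc, whisker_exchange_assoc,
    associator_naturality_right_assoc, ← reassoc_of% e, associator_inv_naturality_middle]

variable (f h) in
/-- The 1-cell of the lax comma object with the given components. -/
def arrow : (⟨x, a.snd, f⟩ : LaxComma P F) ⟶ (inclusion P F).obj a :=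
  LaxComma.Hom.mk h (𝟙 a.snd) g.hom

theorem arrow_comp_cell (u : a ⟶ a') : (arrow f h g ≫ (inclusion P F).map u).cell =
    (paste g u.w).hom ≫ (P.mapComp h u.fst).inv ▷ eqToHom a'.w := by
  rw [LaxComma.comp_cell]
  change f ◁ (F.mapComp (𝟙 a.snd) u.snd).hom ≫ (α_ _ _ _).inv ≫ g.hom ▷ F.map u.snd ≫
    (α_ _ _ _).hom ≫ P.map h ◁ eqToHom (eqToHom_comp_eq a.w a'.w u.w) ≫ (α_ _ _ _).inv ≫
      (P.mapComp h u.fst).inv ▷ eqToHom a'.w = _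
  simp only [paste, Iso.trans_hom, Iso.symm_hom, whiskerLeftIso_hom, whiskerRightIso_hom,
    eqToIso.hom, Category.assoc]

/-- The opcartesian property of `h` handles the component in `K`, while the component in `J` is
carried along unchanged up to unitors. The cell `g` may be any isomorphism of the stated type, which
covers both the arrows out of general objects and the identities of the objects in the image. -/
theorem isBiuniversal_arrow (hh : IsOpcartesian P h) (hP : IsLocalFibration P)
    (hL : IsLocallyGroupoid L) : IsBiuniversal (inclusion P F) (arrow f h g) where
  exists_lift a' k := by
    obtain ⟨s, t, κ⟩ := k
    change x ⟶ a'.fst at s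
    change a.snd ⟶ a'.snd at t
    change f ≫ F.map t ⟶ P.map s ≫ eqToHom a'.w at κ
    -- `t'` is `F t` transported to end points of the form `P _`; a strict lift of it pairs with `t`
    -- to a 1-cell of the pullback.
    obtain ⟨t', ht'⟩ := exists_heq_hom a.w a'.w (F.map t)
    -- Opcartesian 1-cells extend only along invertible 2-cells; this is where the invertibility of
    -- the 2-cells of `L` enters.
    have : IsIso κ := (hL _ _).all_isIso κ
    obtain ⟨α, hα⟩ := exists_iso_whiskerRight_eqToHom a'.w ((paste g ht').symm ≪≫
      whiskerLeftIso f (F.map₂Iso (λ_ t)) ≪≫ asIso κ)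
    obtain ⟨s', rfl, top, hs'⟩ := hh.exists_strict_lift hP s t' α
    refine ⟨⟨s', t, ht'⟩, ⟨LaxComma.isoMk top (λ_ t) ?_⟩⟩
    refine (congrArg (fun r => r ≫ _) (arrow_comp_cell g ⟨s', t, ht'⟩)).trans ?_
    change ((paste g ht').hom ≫ (P.mapComp h s').inv ▷ eqToHom a'.w) ≫
      P.map₂ top.hom ▷ eqToHom a'.w = f ◁ F.map₂ (λ_ t).hom ≫ κ
    rw [eqToHom_refl, whiskerLeft_id, Category.id_comp] at hs'
    rw [hs'] at hα
    rw [Category.assoc, ← comp_whiskerRight, hα]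
    simp only [Iso.trans_hom, Iso.symm_hom, Iso.hom_inv_id_assoc]
    rfl
  existsUnique_lift₂ a' u v φ := by
    obtain ⟨ρ, γ', w⟩ := φ
    change h ≫ u.fst ⟶ h ≫ v.fst at ρ
    change 𝟙 a.snd ≫ u.snd ⟶ 𝟙 a.snd ≫ v.snd at γ'
    obtain ⟨γ, rfl⟩ : ∃ γ : u.snd ⟶ v.snd, 𝟙 _ ◁ γ = γ' :=
      ⟨(λ_ _).inv ≫ γ' ≫ (λ_ _).hom, by simp⟩
    obtain ⟨β, hβ⟩ := exists_heq_hom₂ a.w a'.w u.w v.w (F.map₂ γ)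
    have w₁ : ((paste g u.w).hom ≫ (P.mapComp h u.fst).inv ▷ eqToHom a'.w) ≫
        P.map₂ ρ ▷ eqToHom a'.w = f ◁ F.map₂ (𝟙 a.snd ◁ γ) ≫
          (paste g v.w).hom ≫ (P.mapComp h v.fst).inv ▷ eqToHom a'.w := by
      rw [← arrow_comp_cell, ← arrow_comp_cell]
      exact w
    have w' : (P.mapComp h u.fst).inv ≫ P.map₂ ρ = P.map h ◁ β ≫ (P.mapComp h v.fst).inv := by
      apply whiskerRight_eqToHom_injective a'.w
      rw [← Category.assoc (f ◁ _), paste_naturality g u.w v.w hβ] at w₁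
      simp only [Category.assoc, cancel_epi] at w₁
      rw [comp_whiskerRight, comp_whiskerRight, w₁]
    -- Every 1-cell out of the target of `h` is tautologically a lift of its own composite with `h`,
    -- with identity 2-cells; between such lifts the 2-dimensional property says that `χ` is
    -- determined by `β` and `ρ`.
    obtain ⟨χ, ⟨hχ, hχ'⟩, huniq⟩ := hh.existsUnique_lift₂ (P.mapComp h u.fst).symm
      (P.mapComp h v.fst).symm ⟨u.fst, Iso.refl _, Iso.refl _, by simp⟩
      ⟨v.fst, Iso.refl _, Iso.refl _, by simp⟩ β ρ w'
    simp only [Iso.refl_hom, Category.comp_id, Category.id_comp] at hχ hχ' huniq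
    refine ⟨⟨χ, γ, ?_⟩, ?_, ?_⟩
    · rw [hχ]; exact hβ
    · exact LaxComma.hom₂_ext hχ'.symm rfl
    · rintro ⟨χ₁, γ₁, hw⟩ he
      have h₁ : h ◁ χ₁ = ρ := congrArg LaxComma.Hom₂.fst he
      have h₂ : 𝟙 a.snd ◁ γ₁ = 𝟙 a.snd ◁ γ := congrArg LaxComma.Hom₂.snd he
      obtain rfl : γ₁ = γ := whiskerLeft_injective_of_iso (Iso.refl _) h₂
      exact StrictPullback.hom₂_ext (huniq _ ⟨eq_of_heq (hw.trans hβ.symm), h₁.symm⟩) rfl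

end StrictPullback

end TwoCat

theorem mainTheorem1 {K L J : Type u}
    [Bicategory.{u, u} K] [Bicategory.{u, u} L] [Bicategory.{u, u} J]
    [Bicategory.Strict K] [Bicategory.Strict L] [Bicategory.Strict J]
    (P : StrictPseudofunctor K L) (F : StrictPseudofunctor J L)
    (hP : TwoCat.IsOpfibration P) (hL : IsLocallyGroupoid L) :
    TwoCat.IsHomotopyEquivalence
      (TwoCat.classifyingMap (TwoCat.StrictPullback.inclusion P F)) := by
  refine TwoCat.isHomotopyEquivalence_of_isBiuniversal ?_ fun a => ?_
  · rintro ⟨x, z, f⟩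
    obtain ⟨x', h, e, rfl, hh⟩ := hP.exists_opcartesian f
    exact ⟨⟨x', z, e⟩, _, TwoCat.StrictPullback.isBiuniversal_arrow (a := ⟨x', z, e⟩)
      (whiskerLeftIso (P.map h ≫ eqToHom e) (F.mapId z) ≪≫ ρ_ _) hh hP.isLocalFibration hL⟩
  -- The isomorphism supplied is the structural 2-cell of the identity 1-cell of the comma object,
  -- so the resulting arrow is that identity by definition.
  · exact TwoCat.StrictPullback.isBiuniversal_arrow (h := 𝟙 a.fst)
      (whiskerLeftIso (eqToHom a.w) (F.mapId a.snd) ≪≫ ρ_ (eqToHom a.w) ≪≫ (λ_ (eqToHom a.w)).symm ≪≫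
        whiskerRightIso (P.mapId a.fst).symm (eqToHom a.w))
      (TwoCat.isOpcartesian_id a.fst) hP.isLocalFibration hL
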